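/- Let $n\ge 1$, let $X$ be the weight lattice of $SL_{n+1}(\mathbb C)$, with simple roots $\alpha_1,\dots,\alpha_n$, positive roots $\Phi_+$, dominant weights $X_+$ and Weyl group $W$. For $\lambda\in X_+$ let $\mathcal B(\lambda)$ be the crystal of the irreducible representation of highest weight $\lambda$, with crystal operators $e_i,f_i$ $(1\le i\le n)$ and weight function $\mathrm{wt}$. The group $W$ acts on $\mathcal B(\lambda)$, the simple reflection $s_i$ acting by reversing each $\alpha_i$-string. For $\alpha\in\Phi_+$ put $\tilde f_\alpha=w f_n w^{-1}$, where $w\in W$ satisfies $w(\alpha_n)=\alpha$ (this does not depend on the choice of $w$). Let $\mathbb B^+(\lambda)$ be the graph whose vertices are the $T\in\mathcal B(\lambda)$ with $\mathrm{wt}(T)\in X_+$, with an edge between $T$ and $T'$ whenever $\tilde f_\alpha(T')=T$ for some $\alpha\in\Phi_+$. For $T\in\mathcal B(\lambda)$ let $\bar T$ be the unique element of the orbit $W\cdot T$ with $\mathrm{wt}(\bar T)\in X_+$. Call $T,T'\in\mathcal B(\lambda)$ LL-equivalent if $\bar T$ and $\bar T'$ lie in the same connected component of $\mathbb B^+(\lambda)$;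 the equivalence classes are the LL (Lecouvey–Lenart) atoms of $\mathcal B(\lambda)$. Let $\mathbb B_1(\lambda)$ be the graph whose vertices are all elements of $\mathcal B(\lambda)$, with an edge between $T$ and $T'$ if and only if $T=w(T')$ for some $w\in W$ or $T=f_n(T')$. Then, for every $\lambda\in X_+$: 1. The connected components of $\mathbb B_1(\lambda)$ are exactly the LL atoms of $\mathcal B(\lambda)$. 2. The connected components of $\mathbb B_1(\lambda)$ form an atomic decomposition of $\mathcal B(\lambda)$: they partition $\mathcal B(\lambda)$, and for each component $\mathcal A$ the elements of $\mathcal A$ have pairwise distinct weights and there is $\mu\in X_+$ with $$\{\mathrm{wt}(T)\mid T\in\mathcal A\}=\{\nu\in X\mid \nu\le\mu\},$$ where $\le$ is the Bruhat order on $X\cong \widehat W_{ext}/W$ ($\widehat W_{ext}=W\ltimes X$ the extended affine Weyl group), i.e. the order generated by the relations $t\mu<\mu$ for affine reflections $t$ that decrease the length of the minimal representative of the coset of $\mu$, normalized so that the dominant weight is the largest element of each $W$-orbit. -/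

import Mathlib

/-!
Crystals of type `A_n`, i.e. for `SL_{n+1}(ℂ)`.

* The simple roots are indexed by `i : Fin n` (so `α₁, …, αₙ` are the indices `0, …, n-1`).
* The vector representation has the crystal basis `Fin (n + 1)`, with `fᵢ` sending the letter `i`
  to the letter `i + 1`.  Words `List (Fin (n + 1))` are the elements of its tensor powers.
* A weight is given by its coordinates in the basis of fundamental weights, i.e. `μ i` is the
  pairing of `μ` with the `i`-th simple coroot.
-/

namespace SLCrystal

variable {n : ℕ}

/-! ### Weights, roots, and the Bruhat order on weights -/

/-- The weight lattice `X`; the coordinate `μ i` is `⟨μ, αᵢ^∨⟩`. -/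
abbrev Weight (n : ℕ) : Type := Fin n → ℤ

/-- `μ ∈ X₊`. -/
def IsDominant (μ : Weight n) : Prop := ∀ i, 0 ≤ μ i

/-- The simple root `αᵢ`, whose coordinates are the entries of the Cartan matrix of type `A_n`. -/
def simpleRoot (i : Fin n) : Weight n := fun j => CartanMatrix.A n i j

/-- `α_{j,k} = αⱼ + ⋯ + αₖ`.  For `j ≤ k` these are exactly the positive roots. -/
def posRoot (j k : Fin n) : Weight n := ∑ i ∈ Finset.Icc j k, simpleRoot i

/-- The pairing `⟨μ, α_{j,k}^∨⟩`. -/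
def pairing (μ : Weight n) (j k : Fin n) : ℤ := ∑ i ∈ Finset.Icc j k, μ i

/-- `Φ₊`. -/
def IsPosRoot (α : Weight n) : Prop := ∃ j k : Fin n, j ≤ k ∧ α = posRoot j k

/-- The simple reflection `sᵢ` on weights. -/
def reflWeight (i : Fin n) (μ : Weight n) : Weight n := μ - μ i • simpleRoot i

/-- The element `s_{i₁} ⋯ s_{iᵣ}` of the Weyl group, acting on weights. -/
def actWeight (l : List (Fin n)) (μ : Weight n) : Weight n := l.foldr reflWeight μ

/-- `BruhatStep ν μ`: there is an affine reflection, in a hyperplane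
`{x | ⟨x, α_{j,k}^∨⟩ = m}`, sending `μ` to `ν`, and this hyperplane strictly separates `μ` from the
base alcove (the alcove at the origin in the antidominant chamber, on which `α_{j,k}^∨` takes
values in the interval `(-1, 0)`).
Under `X ≅ W_ext / W` these are precisely the affine reflections which decrease
the length of the minimal coset representative; the dominant weight is the largest
element of its Weyl group orbit. -/
def BruhatStep (ν μ : Weight n) : Prop :=
  ∃ j k : Fin n, j ≤ k ∧ ∃ m : ℤ,
    ν = μ - (pairing μ j k - m) • posRoot j k ∧
      ((0 ≤ m ∧ m < pairing μ j k) ∨ (m < 0 ∧ pairing μ j k < m))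

/-- The Bruhat order `ν ≤ μ` on `X`. -/
def BruhatLE (ν μ : Weight n) : Prop := Relation.ReflTransGen BruhatStep ν μ

/-! ### The crystal of words -/

/-- Words, i.e. elements of the tensor powers of the crystal of the vector representation. -/
abbrev Word (n : ℕ) : Type := List (Fin (n + 1))

/-- `φᵢ`, computed by the tensor product rule
`φᵢ(x ⊗ y) = φᵢ(x) + max(0, φᵢ(y) - εᵢ(x))` (subtraction is truncated). -/
def phi (i : Fin n) : Word n → ℕ
  | [] => 0
  | a :: w => (if a = i.castSucc then 1 else 0) + (phi i w - if a = i.succ then 1 else 0)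

/-- `εᵢ`, computed by the tensor product rule
`εᵢ(x ⊗ y) = εᵢ(y) + max(0, εᵢ(x) - φᵢ(y))` (subtraction is truncated). -/
def eps (i : Fin n) : Word n → ℕ
  | [] => 0
  | a :: w => eps i w + ((if a = i.succ then 1 else 0) - phi i w)

/-- The crystal operator `fᵢ` (`none` stands for `0`), by the tensor product rule
`fᵢ(x ⊗ y) = x ⊗ fᵢ(y)` if `φᵢ(y) > εᵢ(x)`, and `fᵢ(x ⊗ y) = fᵢ(x) ⊗ y` otherwise. -/
def wordF (i : Fin n) : Word n → Option (Word n)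
  | [] => none
  | a :: w =>
    if (if a = i.succ then 1 else 0) < phi i w then (wordF i w).map (a :: ·)
    else if a = i.castSucc then some (i.succ :: w) else none

/-- The crystal operator `eᵢ` (`none` stands for `0`), by the tensor product rule
`eᵢ(x ⊗ y) = eᵢ(x) ⊗ y` if `εᵢ(x) > φᵢ(y)`, and `eᵢ(x ⊗ y) = x ⊗ eᵢ(y)` otherwise. -/
def wordE (i : Fin n) : Word n → Option (Word n)
  | [] => none
  | a :: w =>
    if phi i w < (if a = i.succ then 1 else 0) then some (i.castSucc :: w)
    else (wordE i w).map (a :: ·)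

/-- The weight of a word: `⟨wt w, αᵢ^∨⟩` is the number of letters `i` minus the number of
letters `i + 1`. -/
def wordWt (w : Word n) : Weight n := fun i => (w.count i.castSucc : ℤ) - (w.count i.succ : ℤ)

/-- The simple reflection `sᵢ` reverses each `αᵢ`-string
`eᵢ^ε(w), …, w, …, fᵢ^φ(w)`: it applies `fᵢ^(φ - ε)` if `φ ≥ ε` and `eᵢ^(ε - φ)` if `ε ≥ φ`.
(With truncated subtraction one of the two exponents is always zero; the default value of `getD`
is never used, since `fᵢ` can be applied `φ` times and `eᵢ` can be applied `ε` times.) -/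
def wordRefl (i : Fin n) (w : Word n) : Word n :=
  (fun v => (wordE i v).getD v)^[eps i w - phi i w]
    ((fun v => (wordF i v).getD v)^[phi i w - eps i w] w)

/-! ### The crystal `B(λ)` -/

/-- The highest weight element of weight `ϖ_{i+1}` (`i` counted from `0`) in the tensor power of
the vector representation: the column `i, i - 1, …, 0`. -/
def column (i : Fin n) : Word n := ((List.finRange (n + 1)).filter (· ≤ i.castSucc)).reverse

/-- The highest weight element of weight `λ = ∑ᵢ λᵢ ϖᵢ`: a tensor product of columns,
`λᵢ` of them of weight `ϖᵢ`. -/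
def highestWord (lam : Fin n → ℕ) : Word n :=
  (List.finRange n).flatMap fun i => (List.replicate (lam i) (column i)).flatten

/-- Two words are joined by an arrow of the crystal graph, in either direction. -/
def CrystalAdj (v w : Word n) : Prop := ∃ i : Fin n, wordF i v = some w ∨ wordE i v = some w

/-- The crystal `B(λ)`, for the dominant weight `λ = ∑ᵢ λᵢ ϖᵢ`: the connected component of the
highest weight element of weight `λ` in a tensor power of the crystal of the vector
representation. -/
def Crystal (lam : Fin n → ℕ) : Type :=
  {w : Word n // Relation.ReflTransGen CrystalAdj (highestWord lam) w}

namespace Crystal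

variable {lam : Fin n → ℕ}

/-- The weight of an element of `B(λ)`. -/
def wt (T : Crystal lam) : Weight n := wordWt T.1

/-- The crystal operator `fᵢ` on `B(λ)`; `none` stands for `0`. -/
def f (i : Fin n) (T : Crystal lam) : Option (Crystal lam) :=
  (wordF i T.1).pmap (fun w hw => ⟨w, hw⟩)
    (fun _ hw => T.2.tail ⟨i, Or.inl hw⟩)

theorem refl_mem (i : Fin n) (T : Crystal lam) :
    Relation.ReflTransGen CrystalAdj (highestWord lam) (wordRefl i T.1) := by
  have key : ∀ (g : Word n → Option (Word n)),
      (∀ v w, g v = some w → CrystalAdj v w) → ∀ (k : ℕ) (v : Word n),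
      Relation.ReflTransGen CrystalAdj (highestWord lam) v →
      Relation.ReflTransGen CrystalAdj (highestWord lam) ((fun v => (g v).getD v)^[k] v) := by
    intro g hg k
    induction k with
    | zero => intro v hv; exact hv
    | succ k ih =>
      intro v hv
      rw [Function.iterate_succ_apply]
      apply ih
      cases h : g v with
      | none => simpa using hv
      | some w => simpa using hv.tail (hg v w h)
  exact key _ (fun v w h => ⟨i, Or.inr h⟩) _ _ (key _ (fun v w h => ⟨i, Or.inl h⟩) _ _ T.2)

/-- The action of the simple reflection `sᵢ` on `B(λ)`, reversing the `αᵢ`-strings. -/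
def refl (i : Fin n) (T : Crystal lam) : Crystal lam := ⟨wordRefl i T.1, refl_mem i T⟩

/-- The action on `B(λ)` of the Weyl group element `w = s_{i₁} ⋯ s_{iᵣ}`.  Elements of `W` are
given by words in the simple reflections; the inverse of `w` is given by the reversed word. -/
def act (l : List (Fin n)) (T : Crystal lam) : Crystal lam := l.foldr refl T

/-- `T = w(T')` for some `w ∈ W`. -/
def SameOrbit (T T' : Crystal lam) : Prop := ∃ l : List (Fin n), T = act l T'

end Crystal

open Crystal

/-- The index of the last simple root `αₙ`. -/
def lastIdx (n : ℕ) [NeZero n] : Fin n := ⟨n - 1, Nat.sub_one_lt (NeZero.ne n)⟩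

/-! ### The two graphs, and the atoms -/

section Atoms

variable [NeZero n] (lam : Fin n → ℕ)

/-- `T = f̃_α(T')`, where `f̃_α = w fₙ w⁻¹` for `w ∈ W` with `w(αₙ) = α` (the operator does not
depend on the choice of such a `w`). -/
def ModF (α : Weight n) (T' T : Crystal lam) : Prop :=
  ∃ l : List (Fin n), actWeight l (simpleRoot (lastIdx n)) = α ∧
    (f (lastIdx n) (act l.reverse T')).map (act l) = some T

/-- `B⁺(λ)`, the elements of `B(λ)` of dominant weight. -/
def DominantPart : Type := {T : Crystal lam // IsDominant T.wt}

/-- The undirected graph underlying `𝔹⁺(λ)`: the vertices are the elements of dominant weight, and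
there is an edge between `T` and `T'` whenever `T = f̃_α(T')` for some positive root `α`. -/
def graphPlus : SimpleGraph (DominantPart lam) :=
  SimpleGraph.fromRel fun T T' => ∃ α, IsPosRoot α ∧ ModF lam α T'.1 T.1

/-- LL-equivalence: the elements `T̄` and `T̄'` of dominant weight in the Weyl group orbits of
`T` and `T'` lie in the same connected component of `𝔹⁺(λ)`. -/
def LLEquiv (T T' : Crystal lam) : Prop :=
  ∃ D D' : DominantPart lam, SameOrbit D.1 T ∧ SameOrbit D'.1 T' ∧ (graphPlus lam).Reachable D D'

/-- The LL atoms, i.e. the classes of `B(λ)` with respect to LL-equivalence. -/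
def llAtoms : Set (Set (Crystal lam)) := {A | ∃ T, A = {T' | LLEquiv lam T T'}}

/-- The graph `𝔹₁(λ)`: the vertices are the elements of `B(λ)`, and there is an edge between `T`
and `T'` if `T = w(T')` for some `w ∈ W` or `T = fₙ(T')`.  (Loops, which do not affect
connectedness, are dropped.) -/
def graphOne : SimpleGraph (Crystal lam) :=
  SimpleGraph.fromRel fun T T' => SameOrbit T T' ∨ f (lastIdx n) T' = some T

/-- The vertex sets of the connected components of `𝔹₁(λ)`. -/
def graphOneComponents : Set (Set (Crystal lam)) :=
  Set.range fun c : (graphOne lam).ConnectedComponent => c.supp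

end Atoms

/-- An atomic decomposition of `B(λ)`: a partition into sets such that the elements of each of them
have pairwise distinct weights, which form a lower interval `{ν | ν ≤ μ}` with `μ ∈ X₊` in the
Bruhat order. -/
def IsAtomicDecomposition (lam : Fin n → ℕ) (P : Set (Set (Crystal lam))) : Prop :=
  Setoid.IsPartition P ∧ ∀ A ∈ P,
    Set.InjOn (fun T : Crystal lam => T.wt) A ∧
      ∃ μ : Weight n, IsDominant μ ∧ (fun T : Crystal lam => T.wt) '' A = {ν | BruhatLE ν μ}

end SLCrystal

/-!
Reversing the alphabet turns `fₙ` into an operator on the letters `0` and `1` of words over `ℕ`,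
and the weight of a word into the list of the multiplicities of its letters. Weyl group orbits of
words are studied first, with no reference to `B(λ)`.

Row insertion on three adjacent letters commutes with the crystal operators. It provides a `key` of
a word which is invariant under the two reflections on these letters and determines the word
together with its multiplicities (`eq_of_key_eq`). Hence the reflections satisfy the braid relation
(`cS_braid`), and sorting the multiplicities by reflections is confluent, so that an orbit contains
exactly one word for every arrangement of its multiset of multiplicities (`Orb.eq_of_count`,
`exists_orb_of_perm`).

Applying `f_0` to an element of an orbit in which the letters `0` and `1` occur `a` and `b` times
defines a move between orbits which depends on `a` and `b` only (`Orbit.Move`), and is injective.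
If `b + 2 ≤ a`, this is the relation `Orbit.Down`: it is what the operators `f̃_α` do with dominant
elements, and all arrows of `f_0` are of this form up to the Weyl group. The heart of the proof is
that `Down` is confluent in both directions (`Orbit.down_confluent`, `Orbit.up_confluent`). For
moves which involve three letters in all, this follows from the key: a move keeps it, and whether
an inverse move exists is an inequality for its numerical part. Moves with four letters are
composed of moves with three letters, in one case by a comparison of the keys of two triples
(`level_cS_le`). By Newman's lemma a class of orbits under moves has a largest element
(`Orbit.exists_top`) and a unique lowest one, and following the same moves down to the latter shows
that an orbit of the class is determined by its multiplicities (`Orbit.eq_of_eqvGen`).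

The components of `𝔹₁(λ)` and the LL atoms are both the classes of orbits under moves
(`reachable_iff`, `llEquiv_iff`); this gives the first claim. On a class the weights are distinct
since they determine the multiplicities. If `D` is the dominant element of the largest orbit, every
element of the class is reached from `D` by moves between dominant elements and by unsorting, which
are steps down in the Bruhat order; conversely, every such step stays within a string of a
conjugate of `fₙ`, hence in the class (`exists_of_bruhatStep`). So the weights of the class are
those below the weight of `D`.
-/

namespace SLCrystal

/-! ### Crystal operators on words over the natural numbers -/

/-- The function `ε_j` of the crystal of words over `ℕ` in which `cF j` turns a letter `j` into
`j + 1`. Words are read from the right: a letter `j` cancels a letter `j + 1` to the right of it,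
and `ceps j w` counts the letters `j + 1` that remain. -/
def ceps (j : ℕ) : List ℕ → ℕ
  | [] => 0
  | b :: w => (if b = j + 1 then 1 else 0) + (ceps j w - if b = j then 1 else 0)

/-- The function `φ_j`: the number of letters `j` that remain after cancellation, see `ceps`. -/
def cphi (j : ℕ) : List ℕ → ℕ
  | [] => 0
  | b :: w => cphi j w + ((if b = j then 1 else 0) - ceps j w)

/-- The crystal operator `e_j`, which turns a letter `j + 1` into `j`. -/
def cE (j : ℕ) : List ℕ → Option (List ℕ)
  | [] => none
  | b :: w =>
    if (if b = j then 1 else 0) < ceps j w then (cE j w).map (b :: ·)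
    else if b = j + 1 then some (j :: w) else none

/-- The crystal operator `f_j`, which turns a letter `j` into `j + 1`. -/
def cF (j : ℕ) : List ℕ → Option (List ℕ)
  | [] => none
  | b :: w =>
    if ceps j w < (if b = j then 1 else 0) then some ((j + 1) :: w)
    else (cF j w).map (b :: ·)

theorem cF_cons_eq_some {j b : ℕ} {w v : List ℕ} :
    cF j (b :: w) = some v ↔
      (b = j ∧ ceps j w = 0 ∧ v = (j + 1) :: w) ∨
      ((b = j → ceps j w ≠ 0) ∧ ∃ w', cF j w = some w' ∧ v = b :: w') := by
  simp only [cF]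
  by_cases hb : b = j
  · by_cases h0 : ceps j w = 0
    · simp [hb, h0, eq_comm]
    · have : ¬ ceps j w < 1 := by omega
      simp [hb, h0, this, eq_comm]
  · simp [hb, eq_comm]

theorem cF_eps {j : ℕ} : ∀ {w v : List ℕ}, cF j w = some v →
    ceps j v = ceps j w + 1 ∧ cphi j w = cphi j v + 1
  | [], v, h => by simp [cF] at h
  | b :: w, v, h => by
    rcases cF_cons_eq_some.1 h with ⟨rfl, h0, rfl⟩ | ⟨h0, w', hw', rfl⟩
    · simp [ceps, cphi, h0]
    · have ih := cF_eps hw'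
      simp only [ceps, cphi]
      by_cases hb : b = j
      · have := h0 hb
        simp only [hb, if_true]
        split_ifs <;> omega
      · simp only [hb, if_false]
        split_ifs <;> omega

theorem cF_iff_cE {j : ℕ} : ∀ {w v : List ℕ}, cF j w = some v ↔ cE j v = some w
  | w, [] => by
    cases w with
    | nil => simp [cF, cE]
    | cons b w =>
      simp only [cE, reduceCtorEq, iff_false]
      intro h
      rcases cF_cons_eq_some.1 h with ⟨_, _, h⟩ | ⟨_, _, _, h⟩ <;> simp at h
  | [], c :: v => by
    simp only [cF, cE]
    split_ifs <;> simp
  | b :: w, c :: v => by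
    rw [cF_cons_eq_some]
    simp only [cE]
    constructor
    · rintro (⟨rfl, h0, h⟩ | ⟨h0, w', hw', h⟩)
      · simp only [List.cons.injEq] at h
        simp [h.1, h.2, h0]
      · simp only [List.cons.injEq] at h
        obtain ⟨rfl, rfl⟩ := h
        have h1 := (cF_eps hw').1
        have h2 := cF_iff_cE.1 hw'
        have : (if c = j then 1 else 0) < ceps j v := by
          split_ifs with hc
          · have := h0 hc; omega
          · omega
        rw [if_pos this, h2]; rfl
    · by_cases h1 : (if c = j then 1 else 0) < ceps j v
      · rw [if_pos h1]
        intro h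
        simp only [Option.map_eq_some_iff] at h
        obtain ⟨w', hw', h⟩ := h
        simp only [List.cons.injEq] at h
        obtain ⟨rfl, rfl⟩ := h
        have h3 := cF_iff_cE.2 hw'
        have := (cF_eps h3).1
        refine Or.inr ⟨fun hc => ?_, _, h3, rfl⟩
        rw [if_pos hc] at h1
        omega
      · rw [if_neg h1]
        split_ifs with h3
        · intro h
          simp only [Option.some.injEq, List.cons.injEq] at h
          obtain ⟨rfl, rfl⟩ := h
          left
          refine ⟨rfl, ?_, by rw [h3]⟩
          have : c ≠ j := by omega
          simpa [this] using h1
        · simp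

theorem cF_isSome {j : ℕ} : ∀ {w : List ℕ}, 0 < cphi j w → ∃ v, cF j w = some v
  | [], h => by simp [cphi] at h
  | b :: w, h => by
    by_cases hb : b = j ∧ ceps j w = 0
    · exact ⟨_, cF_cons_eq_some.2 (Or.inl ⟨hb.1, hb.2, rfl⟩)⟩
    · have : 0 < cphi j w := by
        simp only [cphi] at h
        split_ifs at h with h1
        · have : ceps j w ≠ 0 := fun h2 => hb ⟨h1, h2⟩
          omega
        · omega
      obtain ⟨v, hv⟩ := cF_isSome this
      exact ⟨_, cF_cons_eq_some.2 (Or.inr ⟨fun h1 h2 => hb ⟨h1, h2⟩, v, hv, rfl⟩)⟩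

theorem cE_isSome {j : ℕ} : ∀ {w : List ℕ}, 0 < ceps j w → ∃ v, cE j w = some v
  | [], h => by simp [ceps] at h
  | b :: w, h => by
    simp only [cE]
    simp only [ceps] at h
    by_cases h1 : (if b = j then 1 else 0) < ceps j w
    · obtain ⟨v, hv⟩ := cE_isSome (j := j) (w := w) (by omega)
      exact ⟨b :: v, by rw [if_pos h1, hv]; rfl⟩
    · rw [if_neg h1]
      have : b = j + 1 := by
        by_contra hb
        rw [if_neg hb] at h
        omega
      exact ⟨_, by rw [if_pos this]⟩

theorem count_add_ceps (j : ℕ) : ∀ w : List ℕ,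
    w.count j + ceps j w = w.count (j + 1) + cphi j w
  | [] => by simp [ceps, cphi]
  | b :: w => by
    have ih := count_add_ceps j w
    simp only [List.count_cons, ceps, cphi, beq_iff_eq]
    split_ifs <;> omega

theorem cF_count {j : ℕ} : ∀ {w v : List ℕ}, cF j w = some v →
    w.count j = v.count j + 1 ∧ v.count (j + 1) = w.count (j + 1) + 1 ∧
      ∀ k, k ≠ j → k ≠ j + 1 → v.count k = w.count k
  | [], v, h => by simp [cF] at h
  | b :: w, v, h => by
    rcases cF_cons_eq_some.1 h with ⟨rfl, h0, rfl⟩ | ⟨h0, w', hw', rfl⟩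
    · refine ⟨by simp, by simp, fun k h1 h2 => ?_⟩
      rw [List.count_cons_of_ne h1.symm, List.count_cons_of_ne h2.symm]
    · obtain ⟨h1, h2, h3⟩ := cF_count hw'
      simp only [List.count_cons]
      refine ⟨by omega, by omega, fun k hk hk' => by rw [h3 k hk hk']⟩

theorem cF_far_eps {i j : ℕ} (h1 : i + 1 < j ∨ j + 1 < i) : ∀ {w v : List ℕ}, cF j w = some v →
    ceps i v = ceps i w
  | [], v, h => by simp [cF] at h
  | b :: w, v, h => by
    rcases cF_cons_eq_some.1 h with ⟨rfl, h0, rfl⟩ | ⟨h0, w', hw', rfl⟩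
    · simp only [ceps]
      split_ifs <;> omega
    · simp only [ceps, cF_far_eps h1 hw']

/-- Crystal operators whose indices are not adjacent commute. -/
theorem cF_far_comm {i j : ℕ} (h1 : i + 1 < j ∨ j + 1 < i) : ∀ {w v u : List ℕ},
    cF j w = some v → cF i w = some u → ∃ x, cF i v = some x ∧ cF j u = some x
  | [], v, u, h, _ => by simp [cF] at h
  | b :: w, v, u, h, h' => by
    rcases cF_cons_eq_some.1 h with ⟨rfl, h0, rfl⟩ | ⟨h0, w', hw', rfl⟩ <;>
      rcases cF_cons_eq_some.1 h' with ⟨rfl, h0', rfl⟩ | ⟨h0', w'', hw'', rfl⟩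
    · omega
    · refine ⟨(b + 1) :: w'', cF_cons_eq_some.2 (Or.inr ⟨by omega, _, hw'', rfl⟩),
        cF_cons_eq_some.2 (Or.inl ⟨rfl, ?_, rfl⟩)⟩
      rw [cF_far_eps h1.symm hw'', h0]
    · refine ⟨(b + 1) :: w', cF_cons_eq_some.2 (Or.inl ⟨rfl, ?_, rfl⟩),
        cF_cons_eq_some.2 (Or.inr ⟨by omega, _, hw', rfl⟩)⟩
      rw [cF_far_eps h1 hw', h0']
    · obtain ⟨x, hx, hx'⟩ := cF_far_comm h1 hw' hw''
      refine ⟨b :: x, cF_cons_eq_some.2 (Or.inr ⟨fun h => ?_, _, hx, rfl⟩),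
        cF_cons_eq_some.2 (Or.inr ⟨fun h => ?_, _, hx', rfl⟩)⟩
      · rw [cF_far_eps h1 hw']; exact h0' h
      · rw [cF_far_eps h1.symm hw'']; exact h0 h

/-- The variant of `cF_far_comm` for one arrow into and one arrow out of `w`. -/
theorem cF_far_comm' {i j : ℕ} (h1 : i + 1 < j ∨ j + 1 < i) : ∀ {w v u : List ℕ},
    cF j w = some v → cF i u = some w → ∃ x, cF i x = some v ∧ cF j u = some x
  | [], v, u, h, _ => by simp [cF] at h
  | b :: w, v, [], h, h' => by simp [cF] at h'
  | b :: w, v, c :: u, h, h' => by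
    rcases cF_cons_eq_some.1 h with ⟨rfl, h0, rfl⟩ | ⟨h0, w', hw', rfl⟩ <;>
      rcases cF_cons_eq_some.1 h' with ⟨rfl, h0', h2⟩ | ⟨h0', w'', hw'', h2⟩ <;>
      simp only [List.cons.injEq] at h2 <;> obtain ⟨h2, rfl⟩ := h2
    · omega
    · subst h2
      refine ⟨(b + 1) :: u, cF_cons_eq_some.2 (Or.inr ⟨by omega, _, hw'', rfl⟩),
        cF_cons_eq_some.2 (Or.inl ⟨rfl, ?_, rfl⟩)⟩
      rw [← cF_far_eps h1.symm hw'', h0]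
    · subst h2
      refine ⟨c :: w', cF_cons_eq_some.2 (Or.inl ⟨rfl, ?_, rfl⟩),
        cF_cons_eq_some.2 (Or.inr ⟨by omega, _, hw', rfl⟩)⟩
      rw [cF_far_eps h1 hw', h0']
    · subst h2
      obtain ⟨x, hx, hx'⟩ := cF_far_comm' h1 hw' hw''
      refine ⟨b :: x, cF_cons_eq_some.2 (Or.inr ⟨fun h => ?_, _, hx, rfl⟩),
        cF_cons_eq_some.2 (Or.inr ⟨fun h => ?_, _, hx', rfl⟩)⟩
      · rw [cF_far_eps h1 hx']; exact h0' h
      · rw [← cF_far_eps h1.symm hw'']; exact h0 h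

/-! ### Strings and reflections -/

/-- The relation of lying on the same `j`-string. -/
def Str (j : ℕ) (w v : List ℕ) : Prop :=
  Relation.ReflTransGen (fun a b => cF j a = some b) w v ∨
    Relation.ReflTransGen (fun a b => cF j a = some b) v w

theorem cF_inj {j : ℕ} {w w' v : List ℕ} (h : cF j w = some v) (h' : cF j w' = some v) :
    w = w' := by
  rw [cF_iff_cE] at h h'
  exact Option.some.inj (h.symm.trans h')

theorem Str.symm {j : ℕ} {w v : List ℕ} (h : Str j w v) : Str j v w := Or.symm h

theorem Str.refl (j : ℕ) (w : List ℕ) : Str j w w := Or.inl .refl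

theorem Str.trans {j : ℕ} {w v u : List ℕ} (h : Str j w v) (h' : Str j v u) : Str j w u := by
  have hU : Relator.RightUnique (fun a b : List ℕ => cF j a = some b) :=
    fun a b c h h' => Option.some.inj (h.symm.trans h')
  have hU' : Relator.RightUnique (fun b a : List ℕ => cF j a = some b) :=
    fun a b c h h' => cF_inj h h'
  rcases h with h | h <;> rcases h' with h' | h'
  · exact Or.inl (h.trans h')
  · have := Relation.ReflTransGen.total_of_right_unique hU'
      (Relation.ReflTransGen.swap _ _ h) (Relation.ReflTransGen.swap _ _ h')
    rcases this with h | h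
    · exact Or.inr (Relation.ReflTransGen.swap _ _ h)
    · exact Or.inl (Relation.ReflTransGen.swap _ _ h)
  · exact Relation.ReflTransGen.total_of_right_unique hU h h'
  · exact Or.inr (h'.trans h)

theorem Str.of_cF {j : ℕ} {w v : List ℕ} (h : cF j w = some v) : Str j w v :=
  Or.inl (.single h)

/-- Multiplicities of letters along a `j`-string; the number of letters `j` identifies the position
in the string. -/
theorem reach_count {j : ℕ} {w v : List ℕ}
    (h : Relation.ReflTransGen (fun a b => cF j a = some b) w v) :
    v.count j ≤ w.count j ∧ v.count j + v.count (j + 1) = w.count j + w.count (j + 1) ∧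
      (v.count j = w.count j → v = w) ∧
      ∀ k, k ≠ j → k ≠ j + 1 → v.count k = w.count k := by
  induction h with
  | refl => simp
  | tail _ h ih =>
    obtain ⟨h1, h2, h3⟩ := cF_count h
    obtain ⟨i1, i2, i3, i4⟩ := ih
    exact ⟨by omega, by omega, by omega, fun k hk hk' => by rw [h3 k hk hk', i4 k hk hk']⟩

theorem Str.count_add {j : ℕ} {w v : List ℕ} (h : Str j w v) :
    v.count j + v.count (j + 1) = w.count j + w.count (j + 1) := by
  rcases h with h | h
  · exact (reach_count h).2.1
  · exact (reach_count h).2.1.symm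

theorem Str.count_of_ne {j k : ℕ} {w v : List ℕ} (h : Str j w v) (hk : k ≠ j)
    (hk' : k ≠ j + 1) : v.count k = w.count k := by
  rcases h with h | h
  · exact (reach_count h).2.2.2 k hk hk'
  · exact ((reach_count h).2.2.2 k hk hk').symm

theorem Str.eq_of_count {j : ℕ} {w v : List ℕ} (h : Str j w v) (hc : w.count j = v.count j) :
    w = v := by
  rcases h with h | h
  · exact ((reach_count h).2.2.1 hc.symm).symm
  · exact (reach_count h).2.2.1 hc

theorem exists_str_down (j : ℕ) : ∀ (k : ℕ) (w : List ℕ), k ≤ cphi j w →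
    ∃ v, Relation.ReflTransGen (fun a b => cF j a = some b) w v ∧ v.count j + k = w.count j
  | 0, w, _ => ⟨w, .refl, rfl⟩
  | k + 1, w, h => by
    obtain ⟨v, hv⟩ := cF_isSome (j := j) (w := w) (by omega)
    have h1 := cF_eps hv
    obtain ⟨u, hu, hc⟩ := exists_str_down j k v (by omega)
    exact ⟨u, .head hv hu, by have := cF_count hv; omega⟩

theorem exists_str_up (j : ℕ) : ∀ (k : ℕ) (w : List ℕ), k ≤ ceps j w →
    ∃ v, Relation.ReflTransGen (fun a b => cF j a = some b) v w ∧ v.count j = w.count j + k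
  | 0, w, _ => ⟨w, .refl, rfl⟩
  | k + 1, w, h => by
    obtain ⟨v, hv⟩ := cE_isSome (j := j) (w := w) (by omega)
    rw [← cF_iff_cE] at hv
    have h1 := cF_eps hv
    obtain ⟨u, hu, hc⟩ := exists_str_up j k v (by omega)
    exact ⟨u, hu.tail hv, by have := cF_count hv; omega⟩

/-- A `j`-string through a word with `a` letters `j` and `b` letters `j + 1` contains a word with
any number of letters `j` between `a` and `b`. -/
theorem exists_str {j : ℕ} {w : List ℕ} {a : ℕ}
    (h : w.count j ≤ a ∧ a ≤ w.count (j + 1) ∨ w.count (j + 1) ≤ a ∧ a ≤ w.count j) :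
    ∃ v, Str j w v ∧ v.count j = a := by
  have := count_add_ceps j w
  rcases h with ⟨h1, h2⟩ | ⟨h1, h2⟩
  · obtain ⟨v, hv, hc⟩ := exists_str_up j (a - w.count j) w (by omega)
    exact ⟨v, Or.inr hv, by omega⟩
  · obtain ⟨v, hv, hc⟩ := exists_str_down j (w.count j - a) w (by omega)
    exact ⟨v, Or.inl hv, by omega⟩

/-- The reflection `s_j`, reversing the `j`-strings. One of the two exponents is zero, and the
default value of `getD` is never used. -/
def cS (j : ℕ) (w : List ℕ) : List ℕ :=
  (fun v => (cF j v).getD v)^[cphi j w - ceps j w]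
    ((fun v => (cE j v).getD v)^[ceps j w - cphi j w] w)

theorem iterate_cF {j : ℕ} : ∀ (k : ℕ) (w : List ℕ), k ≤ cphi j w →
    Str j w ((fun v => (cF j v).getD v)^[k] w) ∧
      ((fun v => (cF j v).getD v)^[k] w).count j + k = w.count j
  | 0, w, _ => ⟨.refl j w, rfl⟩
  | k + 1, w, h => by
    obtain ⟨v, hv⟩ := cF_isSome (j := j) (w := w) (by omega)
    have h1 := cF_eps hv
    have h2 := cF_count hv
    obtain ⟨ih1, ih2⟩ := iterate_cF (j := j) k v (by omega)
    rw [Function.iterate_succ_apply, hv, Option.getD_some]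
    exact ⟨(Str.of_cF hv).trans ih1, by omega⟩

theorem iterate_cE {j : ℕ} : ∀ (k : ℕ) (w : List ℕ), k ≤ ceps j w →
    Str j w ((fun v => (cE j v).getD v)^[k] w) ∧
      ((fun v => (cE j v).getD v)^[k] w).count j = w.count j + k
  | 0, w, _ => ⟨.refl j w, rfl⟩
  | k + 1, w, h => by
    obtain ⟨v, hv⟩ := cE_isSome (j := j) (w := w) (by omega)
    have hv' := cF_iff_cE.2 hv
    have h1 := cF_eps hv'
    have h2 := cF_count hv'
    obtain ⟨ih1, ih2⟩ := iterate_cE (j := j) k v (by omega)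
    rw [Function.iterate_succ_apply, hv, Option.getD_some]
    exact ⟨(Str.of_cF hv').symm.trans ih1, by omega⟩

theorem cS_str (j : ℕ) (w : List ℕ) : Str j w (cS j w) ∧ (cS j w).count j = w.count (j + 1) := by
  have h := count_add_ceps j w
  rcases le_total (cphi j w) (ceps j w) with h1 | h1
  · obtain ⟨h2, h3⟩ := iterate_cE (j := j) (ceps j w - cphi j w) w (by omega)
    rw [cS, Nat.sub_eq_zero_of_le h1, Function.iterate_zero, id_eq]
    exact ⟨h2, by omega⟩
  · obtain ⟨h2, h3⟩ := iterate_cF (j := j) (cphi j w - ceps j w) w (by omega)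
    rw [cS, Nat.sub_eq_zero_of_le h1, Function.iterate_zero, id_eq]
    exact ⟨h2, by omega⟩

theorem cS_count_left (j : ℕ) (w : List ℕ) : (cS j w).count j = w.count (j + 1) := (cS_str j w).2

theorem cS_count_right (j : ℕ) (w : List ℕ) : (cS j w).count (j + 1) = w.count j := by
  have := (cS_str j w).1.count_add
  have := (cS_str j w).2
  omega

theorem cS_count_of_ne {j k : ℕ} (w : List ℕ) (h : k ≠ j) (h' : k ≠ j + 1) :
    (cS j w).count k = w.count k := (cS_str j w).1.count_of_ne h h'

theorem Str.eq_cS {j : ℕ} {w v : List ℕ} (h : Str j w v) (hc : v.count j = w.count (j + 1)) :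
    v = cS j w :=
  (h.symm.trans (cS_str j w).1).eq_of_count (by rw [hc, cS_count_left])

theorem cS_cS (j : ℕ) (w : List ℕ) : cS j (cS j w) = w :=
  ((cS_str j w).1.symm.eq_cS (cS_count_right j w).symm).symm

theorem cS_of_count_eq {j : ℕ} {w : List ℕ} (h : w.count j = w.count (j + 1)) : cS j w = w :=
  ((Str.refl j w).eq_cS h).symm

theorem Str.far {i j : ℕ} (hij : i + 1 < j ∨ j + 1 < i) {w v w' : List ℕ} (h : Str i w v)
    (hw : cF j w = some w') : ∃ v', cF j v = some v' ∧ Str i w' v' := by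
  rcases h with h | h
  · induction h with
    | refl => exact ⟨w', hw, .refl i w'⟩
    | tail _ h ih =>
      obtain ⟨v', hv', hs⟩ := ih
      obtain ⟨x, hx, hx'⟩ := cF_far_comm hij hv' h
      exact ⟨x, hx', hs.trans (.of_cF hx)⟩
  · induction h using Relation.ReflTransGen.head_induction_on with
    | refl => exact ⟨w', hw, .refl i w'⟩
    | head h _ ih =>
      obtain ⟨v', hv', hs⟩ := ih
      obtain ⟨x, hx, hx'⟩ := cF_far_comm' hij hv' h
      exact ⟨x, hx', hs.trans (Str.of_cF hx).symm⟩

theorem cS_far_cF {i j : ℕ} (hij : i + 1 < j ∨ j + 1 < i) {w v : List ℕ}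
    (h : cF j w = some v) : cF j (cS i w) = some (cS i v) := by
  obtain ⟨x, hx, hs⟩ := (cS_str i w).1.far hij h
  rw [hx, hs.eq_cS]
  rw [(Str.of_cF hx).count_of_ne (by omega) (by omega), cS_count_left,
    (Str.of_cF h).count_of_ne (by omega) (by omega)]

theorem cS_far_str {i j : ℕ} (hij : i + 1 < j ∨ j + 1 < i) {w v : List ℕ}
    (h : Str j w v) : Str j (cS i w) (cS i v) := by
  rcases h with h | h
  · exact Or.inl (h.lift (cS i) fun _ _ => cS_far_cF hij)
  · exact Or.inr (h.lift (cS i) fun _ _ => cS_far_cF hij)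

theorem cS_far_cS {i j : ℕ} (hij : i + 1 < j ∨ j + 1 < i) (w : List ℕ) :
    cS i (cS j w) = cS j (cS i w) := by
  refine (cS_far_str hij (cS_str j w).1).eq_cS ?_
  rw [cS_count_of_ne (j := i) _ (by omega) (by omega), cS_count_left,
    cS_count_of_ne (j := i) _ (by omega) (by omega)]

end SLCrystal

namespace SLCrystal

/-! ### Row insertion on three letters -/

/-- A semistandard tableau with at most three rows in the letters `i`, `i + 1`, `i + 2`, encoded by
the multiplicities of its entries: the first row has `x` letters `i`, `y` letters `i + 1` and `z`
letters `i + 2`, the second row `u` letters `i + 1` and `v` letters `i + 2`, and the third row `t`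
letters `i + 2`. -/
@[ext] structure Tab where
  x : ℕ
  y : ℕ
  z : ℕ
  u : ℕ
  v : ℕ
  t : ℕ

namespace Tab

/-- The columns are strictly increasing. -/
def Valid (T : Tab) : Prop := T.u ≤ T.x ∧ T.u + T.v ≤ T.x + T.y ∧ T.t ≤ T.u

/-- Row insertion of the letter `i`. -/
abbrev insLow (T : Tab) : Tab :=
  if 0 < T.y then
    if 0 < T.v then ⟨T.x + 1, T.y - 1, T.z, T.u + 1, T.v - 1, T.t + 1⟩
    else ⟨T.x + 1, T.y - 1, T.z, T.u + 1, T.v, T.t⟩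
  else if 0 < T.z then ⟨T.x + 1, T.y, T.z - 1, T.u, T.v + 1, T.t⟩
  else ⟨T.x + 1, T.y, T.z, T.u, T.v, T.t⟩

/-- Row insertion of the letter `i + 1`. -/
abbrev insMid (T : Tab) : Tab :=
  if 0 < T.z then ⟨T.x, T.y + 1, T.z - 1, T.u, T.v + 1, T.t⟩
  else ⟨T.x, T.y + 1, T.z, T.u, T.v, T.t⟩

/-- Row insertion of the letter `i + 2`. -/
abbrev insHigh (T : Tab) : Tab := ⟨T.x, T.y, T.z + 1, T.u, T.v, T.t⟩

/-- The crystal operator `f_i` on tableaux: it turns an `i` in the first row into `i + 1`. It is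
defined if `u < x`. -/
abbrev lowerFst (T : Tab) : Tab := ⟨T.x - 1, T.y + 1, T.z, T.u, T.v, T.t⟩

/-- The crystal operator `f_{i+1}` on tableaux, which acts on the first row as long as `v < y`. It
is defined if `v < y` or `t < u`. -/
abbrev lowerSnd (T : Tab) : Tab :=
  if T.v < T.y then ⟨T.x, T.y - 1, T.z + 1, T.u, T.v, T.t⟩
  else ⟨T.x, T.y, T.z, T.u - 1, T.v + 1, T.t⟩

/-- The lengths of the rows. -/
def shape (T : Tab) : ℕ × ℕ × ℕ := (T.x + T.y + T.z, T.u + T.v, T.t)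

theorem insMid_eq_lowerFst_insLow {T : Tab} (hT : T.Valid) (h : T.y = 0) :
    T.insMid = T.insLow.lowerFst ∧ T.insLow.u < T.insLow.x := by
  obtain ⟨x, y, z, u, v, t⟩ := T
  simp only [Valid] at *
  simp only [insLow, insMid, lowerFst, Tab.ext_iff]
  split_ifs <;> (try dsimp only at *) <;> omega

theorem insLow_lowerFst {T : Tab} (hT : T.Valid) (h : T.u < T.x) (hy : T.y ≠ 0) :
    T.lowerFst.insLow = T.insLow.lowerFst ∧ T.insLow.u < T.insLow.x := by
  obtain ⟨x, y, z, u, v, t⟩ := T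
  simp only [Valid] at *
  simp only [insLow, lowerFst, Tab.ext_iff]
  split_ifs <;> (try dsimp only at *) <;> omega

theorem insMid_lowerFst {T : Tab} (hT : T.Valid) (h : T.u < T.x) :
    T.lowerFst.insMid = T.insMid.lowerFst ∧ T.insMid.u < T.insMid.x := by
  obtain ⟨x, y, z, u, v, t⟩ := T
  simp only [Valid] at *
  simp only [insMid, lowerFst, Tab.ext_iff]
  split_ifs <;> (try dsimp only at *) <;> omega

theorem insHigh_lowerFst {T : Tab} (h : T.u < T.x) :
    T.lowerFst.insHigh = T.insHigh.lowerFst ∧ T.insHigh.u < T.insHigh.x := ⟨rfl, h⟩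

theorem insHigh_eq_lowerSnd_insMid {T : Tab} (hT : T.Valid) (h : T.v ≤ T.y) (hz : T.z = 0) :
    T.insHigh = T.insMid.lowerSnd ∧ (T.insMid.v < T.insMid.y ∨ T.insMid.t < T.insMid.u) := by
  obtain ⟨x, y, z, u, v, t⟩ := T
  simp only [Valid] at *
  simp only [insHigh, insMid, lowerSnd, Tab.ext_iff]
  split_ifs <;> (try dsimp only at *) <;> omega

theorem insLow_lowerSnd {T : Tab} (hT : T.Valid) (h : T.v < T.y ∨ T.t < T.u) :
    T.lowerSnd.insLow = T.insLow.lowerSnd ∧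
      (T.insLow.v < T.insLow.y ∨ T.insLow.t < T.insLow.u) := by
  obtain ⟨x, y, z, u, v, t⟩ := T
  simp only [Valid] at *
  simp only [insLow, lowerSnd, Tab.ext_iff]
  split_ifs <;> (try dsimp only at *) <;> omega

theorem insMid_lowerSnd {T : Tab} (hT : T.Valid) (h : T.v < T.y ∨ T.t < T.u)
    (h0 : T.v ≤ T.y → T.z ≠ 0) :
    T.lowerSnd.insMid = T.insMid.lowerSnd ∧
      (T.insMid.v < T.insMid.y ∨ T.insMid.t < T.insMid.u) := by
  obtain ⟨x, y, z, u, v, t⟩ := T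
  simp only [Valid] at *
  simp only [insMid, lowerSnd, Tab.ext_iff]
  split_ifs <;> (try dsimp only at *) <;> omega

theorem insHigh_lowerSnd {T : Tab} (hT : T.Valid) (h : T.v < T.y ∨ T.t < T.u) :
    T.lowerSnd.insHigh = T.insHigh.lowerSnd ∧
      (T.insHigh.v < T.insHigh.y ∨ T.insHigh.t < T.insHigh.u) := by
  obtain ⟨x, y, z, u, v, t⟩ := T
  simp only [Valid] at *
  simp only [insHigh, lowerSnd, Tab.ext_iff]
  split_ifs <;> (try dsimp only at *) <;> omega

end Tab

open Tab

/-- The insertion tableau of the subword of the letters `i`, `i + 1`, `i + 2`, inserted from the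
right to the left. -/
def tab (i : ℕ) : List ℕ → Tab
  | [] => ⟨0, 0, 0, 0, 0, 0⟩
  | b :: w =>
    if b = i then (tab i w).insLow
    else if b = i + 1 then (tab i w).insMid
    else if b = i + 2 then (tab i w).insHigh
    else tab i w

theorem tab_cons_low (i : ℕ) (w : List ℕ) : tab i (i :: w) = (tab i w).insLow := by simp [tab]
theorem tab_cons_mid (i : ℕ) (w : List ℕ) : tab i ((i + 1) :: w) = (tab i w).insMid := by
  simp [tab]
theorem tab_cons_high (i : ℕ) (w : List ℕ) : tab i ((i + 2) :: w) = (tab i w).insHigh := by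
  simp [tab]
theorem tab_cons_of_ne {i b : ℕ} (w : List ℕ) (h : b ≠ i) (h1 : b ≠ i + 1) (h2 : b ≠ i + 2) :
    tab i (b :: w) = tab i w := by simp [tab, h, h1, h2]

theorem letter_cases (i b : ℕ) :
    b = i ∨ b = i + 1 ∨ b = i + 2 ∨ (b ≠ i ∧ b ≠ i + 1 ∧ b ≠ i + 2) := by omega

/-- Multiplicities and the functions `ε` are read off the insertion tableau. -/
theorem tab_stats (i : ℕ) : ∀ w : List ℕ, (tab i w).Valid ∧
    w.count i = (tab i w).x ∧ w.count (i + 1) = (tab i w).y + (tab i w).u ∧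
    w.count (i + 2) = (tab i w).z + (tab i w).v + (tab i w).t ∧
    ceps i w = (tab i w).y ∧ ceps (i + 1) w = ((tab i w).v - (tab i w).y) + (tab i w).z
  | [] => by simp [tab, ceps, Valid]
  | b :: w => by
    obtain ⟨⟨v1, v2, v3⟩, h1, h2, h3, h4, h5⟩ := tab_stats i w
    simp only [List.count_cons, beq_iff_eq, ceps]
    rcases letter_cases i b with rfl | rfl | rfl | ⟨n1, n2, n3⟩
    · rw [tab_cons_low]
      generalize tab b w = T at *
      simp only [insLow, Valid]
      split_ifs <;> (try simp only) <;> omega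
    · rw [tab_cons_mid]
      generalize tab i w = T at *
      simp only [insMid, Valid]
      split_ifs <;> (try simp only) <;> omega
    · rw [tab_cons_high]
      generalize tab i w = T at *
      simp only [Valid]
      split_ifs <;> omega
    · rw [tab_cons_of_ne w n1 n2 n3]
      generalize tab i w = T at *
      simp only [Valid]
      split_ifs <;> omega

theorem tab_valid (i : ℕ) (w : List ℕ) : (tab i w).Valid := (tab_stats i w).1

/-- Row insertion commutes with the crystal operator `f_i`. -/
theorem tab_cF_fst {i : ℕ} : ∀ {w v : List ℕ}, cF i w = some v →
    tab i v = (tab i w).lowerFst ∧ (tab i w).u < (tab i w).x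
  | [], v, h => by simp [cF] at h
  | b :: w, v, h => by
    obtain ⟨hT, -, -, -, h4, -⟩ := tab_stats i w
    rcases cF_cons_eq_some.1 h with ⟨rfl, h0, rfl⟩ | ⟨h0, w', hw', rfl⟩
    · rw [tab_cons_low, tab_cons_mid]
      exact insMid_eq_lowerFst_insLow hT (h4 ▸ h0)
    · obtain ⟨ih, ih'⟩ := tab_cF_fst hw'
      rcases letter_cases i b with rfl | rfl | rfl | ⟨n1, n2, n3⟩
      · rw [tab_cons_low, tab_cons_low, ih]
        exact insLow_lowerFst hT ih' (h4 ▸ h0 rfl)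
      · rw [tab_cons_mid, tab_cons_mid, ih]
        exact insMid_lowerFst hT ih'
      · rw [tab_cons_high, tab_cons_high, ih]
        exact insHigh_lowerFst ih'
      · rw [tab_cons_of_ne _ n1 n2 n3, tab_cons_of_ne _ n1 n2 n3]
        exact ⟨ih, ih'⟩

/-- Row insertion commutes with the crystal operator `f_{i+1}`. -/
theorem tab_cF_snd {i : ℕ} : ∀ {w v : List ℕ}, cF (i + 1) w = some v →
    tab i v = (tab i w).lowerSnd ∧ ((tab i w).v < (tab i w).y ∨ (tab i w).t < (tab i w).u)
  | [], v, h => by simp [cF] at h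
  | b :: w, v, h => by
    obtain ⟨hT, -, -, -, -, h5⟩ := tab_stats i w
    rcases cF_cons_eq_some.1 h with ⟨rfl, h0, rfl⟩ | ⟨h0, w', hw', rfl⟩
    · rw [tab_cons_mid, tab_cons_high]
      exact insHigh_eq_lowerSnd_insMid hT (by omega) (by omega)
    · obtain ⟨ih, ih'⟩ := tab_cF_snd hw'
      rcases letter_cases i b with rfl | rfl | rfl | ⟨n1, n2, n3⟩
      · rw [tab_cons_low, tab_cons_low, ih]
        exact insLow_lowerSnd hT ih'
      · rw [tab_cons_mid, tab_cons_mid, ih]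
        have := h0 rfl
        exact insMid_lowerSnd hT ih' (by omega)
      · rw [tab_cons_high, tab_cons_high, ih]
        exact insHigh_lowerSnd hT ih'
      · rw [tab_cons_of_ne _ n1 n2 n3, tab_cons_of_ne _ n1 n2 n3]
        exact ⟨ih, ih'⟩

/-! ### A complete invariant of the orbits on three letters -/

/-- The recording tableau, in the form of the list of the shapes of the tableaux of all suffixes,
together with the positions of the letters other than `i`, `i + 1`, `i + 2`. -/
def suffixShapes (i : ℕ) : List ℕ → List ((ℕ × ℕ × ℕ) × Option ℕ)
  | [] => []
  | b :: w =>
    ((tab i (b :: w)).shape, if b = i ∨ b = i + 1 ∨ b = i + 2 then none else some b) ::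
      suffixShapes i w

theorem shape_eq_of_suffixShapes_eq {i : ℕ} {w v : List ℕ}
    (h : suffixShapes i w = suffixShapes i v) : (tab i w).shape = (tab i v).shape := by
  cases w <;> cases v <;> simp_all [suffixShapes]

theorem Tab.insLow_inj {T T' : Tab} (hT : T.Valid) (hT' : T'.Valid) (hs : T.shape = T'.shape)
    (h : T.insLow = T'.insLow) : T = T' := by
  obtain ⟨x, y, z, u, v, t⟩ := T
  obtain ⟨x', y', z', u', v', t'⟩ := T'
  simp only [Valid, shape, Prod.mk.injEq, insLow] at *
  split_ifs at h <;> simp only [Tab.mk.injEq] at * <;> omega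

theorem Tab.insMid_inj {T T' : Tab} (hs : T.shape = T'.shape)
    (h : T.insMid = T'.insMid) : T = T' := by
  obtain ⟨x, y, z, u, v, t⟩ := T
  obtain ⟨x', y', z', u', v', t'⟩ := T'
  simp only [shape, Prod.mk.injEq, insMid] at *
  split_ifs at h <;> simp only [Tab.mk.injEq] at * <;> omega

theorem Tab.insHigh_inj {T T' : Tab} (h : T.insHigh = T'.insHigh) : T = T' := by
  obtain ⟨x, y, z, u, v, t⟩ := T
  obtain ⟨x', y', z', u', v', t'⟩ := T'
  simp only [insHigh, Tab.mk.injEq] at *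
  omega

theorem Tab.insLow_ne_insMid {T T' : Tab} (hT' : T'.Valid)
    (hs : T.shape = T'.shape) : T.insLow ≠ T'.insMid := by
  obtain ⟨x, y, z, u, v, t⟩ := T
  obtain ⟨x', y', z', u', v', t'⟩ := T'
  intro h
  simp only [Valid, shape, Prod.mk.injEq, insLow, insMid] at *
  split_ifs at h <;> simp only [Tab.mk.injEq] at * <;> omega

theorem Tab.insLow_ne_insHigh {T T' : Tab}
    (hs : T.shape = T'.shape) : T.insLow ≠ T'.insHigh := by
  obtain ⟨x, y, z, u, v, t⟩ := T
  obtain ⟨x', y', z', u', v', t'⟩ := T'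
  intro h
  simp only [shape, Prod.mk.injEq, insLow, insHigh] at *
  split_ifs at h <;> simp only [Tab.mk.injEq] at * <;> omega

theorem Tab.insMid_ne_insHigh {T T' : Tab}
    (hs : T.shape = T'.shape) : T.insMid ≠ T'.insHigh := by
  obtain ⟨x, y, z, u, v, t⟩ := T
  obtain ⟨x', y', z', u', v', t'⟩ := T'
  intro h
  simp only [shape, Prod.mk.injEq, insMid, insHigh] at *
  split_ifs at h <;> simp only [Tab.mk.injEq] at * <;> omega

/-- A word is determined by its recording data and its insertion tableau. -/
theorem eq_of_tab_eq {i : ℕ} : ∀ {w v : List ℕ}, suffixShapes i w = suffixShapes i v →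
    tab i w = tab i v → w = v
  | [], [], _, _ => rfl
  | [], c :: v, h, _ => by simp [suffixShapes] at h
  | b :: w, [], h, _ => by simp [suffixShapes] at h
  | b :: w, c :: v, h, ht => by
    simp only [suffixShapes, List.cons.injEq, Prod.mk.injEq] at h
    obtain ⟨⟨-, hl⟩, hq⟩ := h
    have hs := shape_eq_of_suffixShapes_eq hq
    have h1 := tab_valid i w
    have h2 := tab_valid i v
    suffices b = c ∧ tab i w = tab i v by rw [this.1, eq_of_tab_eq hq this.2]
    rcases letter_cases i b with hb | hb | hb | ⟨n1, n2, n3⟩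
    · rcases letter_cases i c with hc | hc | hc | ⟨m1, m2, m3⟩
      · rw [hb, hc, tab_cons_low, tab_cons_low] at ht
        exact ⟨hb.trans hc.symm, insLow_inj h1 h2 hs ht⟩
      · rw [hb, hc, tab_cons_low, tab_cons_mid] at ht
        exact absurd ht (insLow_ne_insMid h2 hs)
      · rw [hb, hc, tab_cons_low, tab_cons_high] at ht
        exact absurd ht (insLow_ne_insHigh hs)
      · simp [hb, m1, m2, m3] at hl
    · rcases letter_cases i c with hc | hc | hc | ⟨m1, m2, m3⟩
      · rw [hb, hc, tab_cons_mid, tab_cons_low] at ht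
        exact absurd ht.symm (insLow_ne_insMid h1 hs.symm)
      · rw [hb, hc, tab_cons_mid, tab_cons_mid] at ht
        exact ⟨hb.trans hc.symm, insMid_inj hs ht⟩
      · rw [hb, hc, tab_cons_mid, tab_cons_high] at ht
        exact absurd ht (insMid_ne_insHigh hs)
      · simp [hb, m1, m2, m3] at hl
    · rcases letter_cases i c with hc | hc | hc | ⟨m1, m2, m3⟩
      · rw [hb, hc, tab_cons_high, tab_cons_low] at ht
        exact absurd ht.symm (insLow_ne_insHigh hs.symm)
      · rw [hb, hc, tab_cons_high, tab_cons_mid] at ht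
        exact absurd ht.symm (insMid_ne_insHigh hs.symm)
      · rw [hb, hc, tab_cons_high, tab_cons_high] at ht
        exact ⟨hb.trans hc.symm, insHigh_inj ht⟩
      · simp [hb, m1, m2, m3] at hl
    · rcases letter_cases i c with hc | hc | hc | ⟨m1, m2, m3⟩
      · simp [hc, n1, n2, n3] at hl
      · simp [hc, n1, n2, n3] at hl
      · simp [hc, n1, n2, n3] at hl
      · rw [tab_cons_of_ne _ n1 n2 n3, tab_cons_of_ne _ m1 m2 m3] at ht
        simp only [n1, n2, n3, m1, m2, m3, or_self, if_false, Option.some.injEq] at hl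
        exact ⟨hl, ht⟩

theorem shape_cF {i j : ℕ} (hj : j = i ∨ j = i + 1) {w v : List ℕ} (h : cF j w = some v) :
    (tab i v).shape = (tab i w).shape := by
  have hT := tab_valid i w
  rcases hj with rfl | rfl
  · obtain ⟨h1, h2⟩ := tab_cF_fst h
    rw [h1]
    simp only [shape, Prod.mk.injEq, and_true]
    omega
  · obtain ⟨h1, h2⟩ := tab_cF_snd h
    rw [h1]
    generalize tab i w = T at *
    obtain ⟨x, y, z, u, v, t⟩ := T
    simp only [Valid, shape, lowerSnd] at *
    split_ifs <;> simp only [Prod.mk.injEq, true_and, and_true] <;> omega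

theorem suffixShapes_cF {i j : ℕ} (hj : j = i ∨ j = i + 1) : ∀ {w v : List ℕ},
    cF j w = some v → suffixShapes i v = suffixShapes i w
  | [], v, h => by simp [cF] at h
  | b :: w, v, h => by
    have hs := shape_cF hj h
    rcases cF_cons_eq_some.1 h with ⟨rfl, h0, rfl⟩ | ⟨h0, w', hw', rfl⟩
    · simp only [suffixShapes, hs]
      rcases hj with rfl | rfl <;> simp
    · simp only [suffixShapes, hs, suffixShapes_cF hj hw']

/-- A number attached to a tableau which does not change under `f_i`, `s_i` and `s_{i+1}`. -/
def Tab.invariant (T : Tab) : ℕ := T.u + min (T.u + T.v) (T.z + T.v + T.t)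

/-- The change of the tableau along an `(i + 1)`-string: of the letters `i + 1` that are turned
into `i + 2`, the first `y - v` lie in the first row and all others in the second row. -/
theorem tab_string_snd {i : ℕ} {w v : List ℕ}
    (h : Relation.ReflTransGen (fun a b => cF (i + 1) a = some b) w v) :
    (tab i v).x = (tab i w).x ∧ (tab i v).t = (tab i w).t ∧
      (tab i v).u + (tab i v).v = (tab i w).u + (tab i w).v ∧
      (tab i v).y + (tab i v).z + (tab i v).x = (tab i w).y + (tab i w).z + (tab i w).x ∧
      (tab i v).y + (tab i v).u ≤ (tab i w).y + (tab i w).u ∧ (tab i v).u ≤ (tab i w).u ∧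
      (tab i w).u - (tab i v).u =
        ((tab i w).y + (tab i w).u - ((tab i v).y + (tab i v).u)) -
          ((tab i w).y - (tab i w).v) := by
  induction h with
  | refl => simp
  | @tail a b _ h ih =>
    obtain ⟨h1, h2⟩ := tab_cF_snd h
    rw [h1]
    generalize tab i a = A at *
    generalize tab i w = B at *
    obtain ⟨x, y, z, u, v, t⟩ := A
    simp only [lowerSnd] at *
    split_ifs <;> dsimp only at * <;> omega

/-- The invariant takes the same value at the two ends of a reflection `s_{i+1}`. (It is not
constant along the string.) -/
theorem invariant_str_snd {i : ℕ} {w v : List ℕ}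
    (h : Relation.ReflTransGen (fun a b => cF (i + 1) a = some b) w v)
    (hc : v.count (i + 1) = w.count (i + 2)) : (tab i v).invariant = (tab i w).invariant := by
  have := tab_string_snd h
  obtain ⟨⟨a1, a2, a3⟩, b1, b2, b3, -⟩ := tab_stats i w
  obtain ⟨⟨a1', a2', a3'⟩, b1', b2', b3', -⟩ := tab_stats i v
  simp only [Tab.invariant]
  omega

/-- The length of the second row of the insertion tableau. -/
def level (i : ℕ) (w : List ℕ) : ℕ := (tab i w).u + (tab i w).v

/-- The type of the values of `key`. -/
abbrev Key : Type := List ((ℕ × ℕ × ℕ) × Option ℕ) × ℕ × ℕ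

/-- The recording data, the level, and the invariant. For fixed multiplicities of the letters `i`,
`i + 1` it determines the word (`eq_of_key_eq`), and it is constant on the orbits of the group
generated by `s_i` and `s_{i+1}`; it is also constant along `i`-strings. The level, which is a
function of the recording data, is a component of its own because inequalities are stated in terms
of it. -/
def key (i : ℕ) (w : List ℕ) : Key :=
  (suffixShapes i w, level i w, (tab i w).invariant)

theorem level_eq_of_suffixShapes_eq {i : ℕ} {w v : List ℕ}
    (h : suffixShapes i w = suffixShapes i v) : level i w = level i v := by
  have := shape_eq_of_suffixShapes_eq h
  simp only [shape, Prod.mk.injEq] at this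
  exact this.2.1

theorem suffixShapes_str {i j : ℕ} (hj : j = i ∨ j = i + 1) {w v : List ℕ} (h : Str j w v) :
    suffixShapes i v = suffixShapes i w := by
  have key : ∀ {w v : List ℕ}, Relation.ReflTransGen (fun a b => cF j a = some b) w v →
      suffixShapes i v = suffixShapes i w := by
    intro w v h
    induction h with
    | refl => rfl
    | tail _ h ih => rw [suffixShapes_cF hj h, ih]
  rcases h with h | h
  · exact key h
  · exact (key h).symm

theorem key_str {i : ℕ} {w v : List ℕ} (h : Str i w v) : key i v = key i w := by
  have main : ∀ {w v : List ℕ}, Relation.ReflTransGen (fun a b => cF i a = some b) w v →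
      (tab i v).invariant = (tab i w).invariant := by
    intro w v h
    induction h with
    | refl => rfl
    | tail _ h ih =>
      rw [← ih, (tab_cF_fst h).1]
      rfl
  have hq := suffixShapes_str (Or.inl rfl) h
  rw [key, key, hq, level_eq_of_suffixShapes_eq hq]
  rcases h with h | h
  · rw [main h]
  · rw [main h]

theorem key_cS_fst (i : ℕ) (w : List ℕ) : key i (cS i w) = key i w := key_str (cS_str i w).1

theorem key_cS_snd (i : ℕ) (w : List ℕ) : key i (cS (i + 1) w) = key i w := by
  have hs := (cS_str (i + 1) w).1
  have hq := suffixShapes_str (Or.inr rfl) hs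
  rw [key, key, hq, level_eq_of_suffixShapes_eq hq]
  rcases hs with h | h
  · rw [invariant_str_snd h (cS_count_left _ w)]
  · rw [invariant_str_snd h (cS_count_right _ w).symm]

theorem eq_of_key_eq {i : ℕ} {w v : List ℕ} (h : key i w = key i v)
    (h0 : w.count i = v.count i) (h1 : w.count (i + 1) = v.count (i + 1)) : w = v := by
  simp only [key, Prod.mk.injEq] at h
  obtain ⟨hq, -, hI⟩ := h
  refine eq_of_tab_eq hq ?_
  have hs := shape_eq_of_suffixShapes_eq hq
  obtain ⟨⟨a1, a2, a3⟩, b1, b2, b3, -⟩ := tab_stats i w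
  obtain ⟨⟨a1', a2', a3'⟩, b1', b2', b3', -⟩ := tab_stats i v
  simp only [Tab.invariant] at hI
  simp only [shape, Prod.mk.injEq] at hs
  rw [Tab.ext_iff]
  omega

/-- The braid relation: both sides have the same key and the same multiplicities. -/
theorem cS_braid (i : ℕ) (w : List ℕ) :
    cS i (cS (i + 1) (cS i w)) = cS (i + 1) (cS i (cS (i + 1) w)) := by
  refine eq_of_key_eq (i := i) ?_ ?_ ?_
  · simp only [key_cS_fst, key_cS_snd]
  · rw [cS_count_left, cS_count_left, cS_count_of_ne (k := i + 1 + 1) _ (by omega) (by omega),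
      cS_count_of_ne (k := i) _ (by omega) (by omega), cS_count_left, cS_count_left]
  · rw [cS_count_right, cS_count_of_ne (k := i) _ (by omega) (by omega), cS_count_left,
      cS_count_left, cS_count_of_ne (k := i + 1 + 1) _ (by omega) (by omega), cS_count_right]

/-- Whether `e_i` is defined depends only on the key and the multiplicities. -/
theorem ceps_pos_iff (i : ℕ) (w : List ℕ) : 0 < ceps i w ↔
    (key i w).2.2 < w.count (i + 1) + min (key i w).2.1 (w.count (i + 2)) := by
  obtain ⟨⟨a1, a2, a3⟩, b1, b2, b3, b4, -⟩ := tab_stats i w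
  simp only [key, level, Tab.invariant]
  omega

/-! ### Dependence of the level on a fourth letter -/

/-- `T'` is obtained from `T` by deleting letters `i + 2`, the others staying in their rows. -/
def Tab.Dominated (T' T : Tab) : Prop :=
  T'.x = T.x ∧ T'.y = T.y ∧ T'.u = T.u ∧ T'.z ≤ T.z ∧ T'.v ≤ T.v ∧ T'.t ≤ T.t

theorem Tab.Dominated.insLow {T' T : Tab} (h : T'.Dominated T) :
    T'.insLow.Dominated T.insLow := by
  simp only [Dominated, Tab.insLow] at *
  split_ifs <;> dsimp only <;> omega

theorem Tab.Dominated.insMid {T' T : Tab} (h : T'.Dominated T) :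
    T'.insMid.Dominated T.insMid := by
  simp only [Dominated, Tab.insMid] at *
  split_ifs <;> dsimp only <;> omega

theorem Tab.Dominated.insHigh {T' T : Tab} (h : T'.Dominated T) :
    T'.insHigh.Dominated T.insHigh := by
  simp only [Dominated] at *
  omega

/-- The operator `f_{i+2}` removes a letter `i + 2`, which is the largest letter of the tableau. -/
theorem dominated_cF {i : ℕ} : ∀ {w v : List ℕ}, cF (i + 2) w = some v →
    (tab i v).Dominated (tab i w)
  | [], v, h => by simp [cF] at h
  | b :: w, v, h => by
    rcases cF_cons_eq_some.1 h with ⟨rfl, h0, rfl⟩ | ⟨h0, w', hw', rfl⟩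
    · rw [tab_cons_high, tab_cons_of_ne _ (by omega) (by omega) (by omega)]
      simp [Dominated]
    · have ih := dominated_cF hw'
      rcases letter_cases i b with rfl | rfl | rfl | ⟨n1, n2, n3⟩
      · rw [tab_cons_low, tab_cons_low]
        exact ih.insLow
      · rw [tab_cons_mid, tab_cons_mid]
        exact ih.insMid
      · rw [tab_cons_high, tab_cons_high]
        exact ih.insHigh
      · rw [tab_cons_of_ne _ n1 n2 n3, tab_cons_of_ne _ n1 n2 n3]
        exact ih

/-- Exchanging the third letter for a fourth one which occurs less often does not raise the level.
-/
theorem level_cS_le {i : ℕ} {w : List ℕ} (h : w.count (i + 3) ≤ w.count (i + 2)) :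
    level i (cS (i + 2) w) ≤ level i w := by
  have main : ∀ {w v : List ℕ}, Relation.ReflTransGen (fun a b => cF (i + 2) a = some b) w v →
      level i v ≤ level i w := by
    intro w v h
    induction h with
    | refl => exact le_rfl
    | tail _ h ih =>
      have := dominated_cF h
      simp only [Dominated, level] at *
      omega
  obtain ⟨hs, hc⟩ := cS_str (i + 2) w
  rcases hs with hs | hs
  · exact main hs
  · have h1 := reach_count hs
    have : w = cS (i + 2) w := h1.2.2.1 (le_antisymm h1.1 (hc.trans_le h))
    rw [← this]

end SLCrystal

namespace SLCrystal

open Relation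

/-! ### Orbits and sorting -/

/-- Newman's lemma: a terminating and locally confluent relation has the Church–Rosser property. -/
theorem join_of_eqvGen {α : Type*} {r : α → α → Prop} (hwf : WellFounded fun b a => r a b)
    (hl : ∀ a b c, r a b → r a c → Join (ReflTransGen r) b c) {a b : α} (h : EqvGen r a b) :
    Join (ReflTransGen r) a b := by
  have conf : ∀ a b c, ReflTransGen r a b → ReflTransGen r a c → Join (ReflTransGen r) b c := by
    intro a
    induction a using hwf.induction with
    | _ a ih =>
      intro b c hb hc
      rcases ReflTransGen.cases_head hb with rfl | ⟨b', hb', hbb⟩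
      · exact ⟨c, hc, .refl⟩
      rcases ReflTransGen.cases_head hc with rfl | ⟨c', hc', hcc⟩
      · exact ⟨b, .refl, hb⟩
      obtain ⟨d, hd, hd'⟩ := hl a b' c' hb' hc'
      obtain ⟨x, hx, hx'⟩ := ih b' hb' b d hbb hd
      obtain ⟨y, hy, hy'⟩ := ih c' hc' c x hcc (hd'.trans hx')
      exact ⟨y, hx.trans hy', hy⟩
  induction h with
  | rel a b h => exact ⟨b, .single h, .refl⟩
  | refl a => exact ⟨a, .refl, .refl⟩
  | symm a b _ ih => obtain ⟨d, h, h'⟩ := ih; exact ⟨d, h', h⟩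
  | trans a b c _ _ ih ih' =>
    obtain ⟨d, h1, h2⟩ := ih
    obtain ⟨d', h3, h4⟩ := ih'
    obtain ⟨x, hx, hx'⟩ := conf b d d' h2 h3
    exact ⟨x, h1.trans hx, h4.trans hx'⟩

/-- The words `w` and `v` are related by reflections `s_j` with `m ≤ j` and `j + 1 < e`, i.e. by
reflections involving only the letters `m, …, e - 1`. -/
def Orb (m e : ℕ) : List ℕ → List ℕ → Prop :=
  ReflTransGen fun w v => ∃ j, m ≤ j ∧ j + 1 < e ∧ v = cS j w

theorem Orb.symm {m e : ℕ} {w v : List ℕ} (h : Orb m e w v) : Orb m e v w := by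
  induction h with
  | refl => exact .refl
  | tail _ h ih =>
    obtain ⟨j, h1, h2, rfl⟩ := h
    exact .head ⟨j, h1, h2, (cS_cS j _).symm⟩ ih

theorem Orb.of_cS {m e j : ℕ} (w : List ℕ) (h : m ≤ j) (h' : j + 1 < e) : Orb m e w (cS j w) :=
  .single ⟨j, h, h', rfl⟩

theorem Orb.mono {m m' e e' : ℕ} {w v : List ℕ} (h : Orb m e w v) (hm : m' ≤ m) (he : e ≤ e') :
    Orb m' e' w v :=
  h.lift id fun _ _ ⟨j, h1, h2, h3⟩ => ⟨j, by omega, by omega, h3⟩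

theorem Orb.count_of_lt {m e k : ℕ} {w v : List ℕ} (h : Orb m e w v) (hk : k < m ∨ e ≤ k) :
    v.count k = w.count k := by
  induction h with
  | refl => rfl
  | tail _ h ih =>
    obtain ⟨j, h1, h2, rfl⟩ := h
    rw [cS_count_of_ne _ (by omega) (by omega), ih]

/-- The list of the multiplicities of the letters `m, …, m + k - 1`. -/
def cnts : ℕ → ℕ → List ℕ → List ℕ
  | _, 0, _ => []
  | m, k + 1, w => w.count m :: cnts (m + 1) k w

theorem cnts_succ (m k : ℕ) (w : List ℕ) : cnts m (k + 1) w = w.count m :: cnts (m + 1) k w := rfl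

theorem cnts_congr {w v : List ℕ} : ∀ {m k : ℕ}, (∀ i, m ≤ i → i < m + k → w.count i = v.count i) →
    cnts m k w = cnts m k v
  | _, 0, _ => rfl
  | m, k + 1, h => by
    rw [cnts, cnts, h m le_rfl (by omega), cnts_congr fun i h1 h2 => h i (by omega) (by omega)]

theorem count_eq_of_cnts_eq {w v : List ℕ} : ∀ {m k : ℕ}, cnts m k w = cnts m k v →
    ∀ i, m ≤ i → i < m + k → w.count i = v.count i
  | m, 0, _, i, h1, h2 => by omega
  | m, k + 1, h, i, h1, h2 => by
    simp only [cnts, List.cons.injEq] at h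
    rcases h1.eq_or_lt with rfl | h1
    · exact h.1
    · exact count_eq_of_cnts_eq h.2 i h1 (by omega)

theorem length_cnts (w : List ℕ) : ∀ m k : ℕ, (cnts m k w).length = k
  | _, 0 => rfl
  | m, k + 1 => by simp [cnts, length_cnts w (m + 1) k]

theorem cnts_cS (w : List ℕ) : ∀ {m k j : ℕ}, m ≤ j → j + 1 < m + k →
    (cnts m k (cS j w)).Perm (cnts m k w)
  | m, 0, j, h, h' => by omega
  | m, 1, j, h, h' => by omega
  | m, k + 2, j, h, h' => by
    rcases h.eq_or_lt with rfl | h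
    · simp only [cnts]
      rw [cS_count_left, cS_count_right, cnts_congr (w := cS m w) (v := w)
        fun i h1 h2 => cS_count_of_ne w (by omega) (by omega)]
      exact .swap _ _ _
    · rw [cnts_succ m (k + 1), cnts_succ m (k + 1), cS_count_of_ne w (by omega) (by omega)]
      exact (cnts_cS w (m := m + 1) (k := k + 1) (by omega) (by omega)).cons _

theorem Orb.cnts_perm {m k : ℕ} {w v : List ℕ} (h : Orb m (m + k) w v) :
    (cnts m k v).Perm (cnts m k w) := by
  induction h with
  | refl => exact .refl _
  | tail _ h ih =>
    obtain ⟨j, h1, h2, rfl⟩ := h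
    exact (cnts_cS _ h1 h2).trans ih

/-- Every rearrangement of the multiplicities is attained in the orbit. -/
theorem exists_orb_of_perm {l l' : List ℕ} (h : l.Perm l') : ∀ {m : ℕ} {w : List ℕ},
    cnts m l.length w = l → ∃ v, Orb m (m + l.length) w v ∧ cnts m l.length v = l' := by
  induction h with
  | nil => exact fun {m w} h => ⟨w, .refl, h⟩
  | cons x h ih =>
    intro m w hw
    simp only [List.length_cons, cnts, List.cons.injEq] at hw
    obtain ⟨v, hv, hc⟩ := ih hw.2
    refine ⟨v, hv.mono (by omega) (by rw [List.length_cons]; omega), ?_⟩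
    simp only [List.length_cons, cnts, hc, List.cons.injEq, and_true]
    rw [hv.count_of_lt (by omega), hw.1]
  | swap x y l =>
    intro m w hw
    simp only [List.length_cons, cnts, List.cons.injEq] at hw
    refine ⟨cS m w, .of_cS w le_rfl (by simp), ?_⟩
    simp only [List.length_cons, cnts]
    rw [cS_count_left, cS_count_right, cnts_congr (w := cS m w) (v := w)
      fun i h1 h2 => cS_count_of_ne w (by omega) (by omega), hw.1, hw.2.1, hw.2.2]
  | trans h1 h2 ih1 ih2 =>
    intro m w hw
    obtain ⟨v, hv, hc⟩ := ih1 hw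
    rw [h1.length_eq] at hc hv
    obtain ⟨u, hu, hc'⟩ := ih2 hc
    rw [h1.length_eq]
    exact ⟨u, hv.trans hu, hc'⟩

/-- A reflection which sorts two adjacent multiplicities into increasing order. -/
def SortStep (e : ℕ) (w v : List ℕ) : Prop :=
  ∃ j, j + 1 < e ∧ w.count (j + 1) < w.count j ∧ v = cS j w

/-- A weighted sum of the multiplicities, which decreases under sorting. -/
def disorder (e : ℕ) (w : List ℕ) : ℕ := ∑ i ∈ Finset.range e, (e - i) * w.count i

theorem disorder_lt {e : ℕ} {w v : List ℕ} (h : SortStep e w v) :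
    disorder e v < disorder e w := by
  obtain ⟨j, hj, hc, rfl⟩ := h
  have h1 : j ∈ Finset.range e := by simp; omega
  have h2 : j + 1 ∈ (Finset.range e).erase j := by simp; omega
  simp only [disorder]
  rw [← Finset.add_sum_erase _ _ h1, ← Finset.add_sum_erase _ _ h2,
    ← Finset.add_sum_erase (a := j) _ (fun i => (e - i) * w.count i) h1,
    ← Finset.add_sum_erase (a := j + 1) _ (fun i => (e - i) * w.count i) h2,
    cS_count_left, cS_count_right, ← add_assoc, ← add_assoc]
  have h3 : ∑ i ∈ ((Finset.range e).erase j).erase (j + 1), (e - i) * (cS j w).count i =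
      ∑ i ∈ ((Finset.range e).erase j).erase (j + 1), (e - i) * w.count i :=
    Finset.sum_congr rfl fun i hi => by
      simp only [Finset.mem_erase] at hi
      rw [cS_count_of_ne w hi.2.1 hi.1]
  rw [h3]
  obtain ⟨d, rfl⟩ := Nat.exists_eq_add_of_lt hj
  have e1 : j + 1 + d + 1 - j = d + 2 := by omega
  have e2 : j + 1 + d + 1 - (j + 1) = d + 1 := by omega
  rw [e1, e2]
  nlinarith

theorem sortStep_wf (e : ℕ) : WellFounded fun v w => SortStep e w v :=
  Subrelation.wf (fun h => disorder_lt h) (measure (disorder e)).wf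

/-- Sorting is locally confluent, by the commutation and braid relations. -/
theorem sortStep_confluent {e : ℕ} {w v u : List ℕ} (h : SortStep e w v) (h' : SortStep e w u) :
    Join (ReflTransGen (SortStep e)) v u := by
  have main : ∀ j k, j < k → k + 1 < e → w.count (j + 1) < w.count j →
      w.count (k + 1) < w.count k → Join (ReflTransGen (SortStep e)) (cS j w) (cS k w) := by
    intro j k hjk hk hcj hck
    rcases Nat.lt_or_ge (j + 1) k with h | h
    · refine ⟨cS j (cS k w), .single ⟨k, hk, ?_, cS_far_cS (.inl h) w⟩,
        .single ⟨j, by omega, ?_, rfl⟩⟩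
      · rw [cS_count_of_ne _ (by omega) (by omega), cS_count_of_ne _ (by omega) (by omega)]
        exact hck
      · rw [cS_count_of_ne _ (by omega) (by omega), cS_count_of_ne _ (by omega) (by omega)]
        exact hcj
    · obtain rfl : k = j + 1 := by omega
      refine ⟨cS j (cS (j + 1) (cS j w)), ?_, ?_⟩
      · refine .tail (.single ⟨j + 1, hk, ?_, rfl⟩) ⟨j, by omega, ?_, rfl⟩
        · rw [cS_count_right, cS_count_of_ne (k := j + 1 + 1) _ (by omega) (by omega)]
          omega
        · rw [cS_count_left, cS_count_of_ne (j := j + 1) (k := j) _ (by omega) (by omega),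
            cS_count_left, cS_count_of_ne (k := j + 1 + 1) _ (by omega) (by omega)]
          exact hck
      · rw [cS_braid]
        refine .tail (.single ⟨j, by omega, ?_, rfl⟩) ⟨j + 1, hk, ?_, rfl⟩
        · rw [cS_count_left, cS_count_of_ne (k := j) _ (by omega) (by omega)]
          omega
        · rw [cS_count_right, cS_count_of_ne (j := j) (k := j + 1 + 1) _ (by omega) (by omega),
            cS_count_right, cS_count_of_ne (k := j) _ (by omega) (by omega)]
          exact hcj
  obtain ⟨j, hj, hcj, rfl⟩ := h
  obtain ⟨k, hk, hck, rfl⟩ := h'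
  rcases lt_trichotomy j k with hjk | rfl | hjk
  · exact main j k hjk hk hcj hck
  · exact ⟨_, .refl, .refl⟩
  · obtain ⟨d, h1, h2⟩ := main k j hjk hj hck hcj
    exact ⟨d, h2, h1⟩

theorem Orb.join {e : ℕ} {w v : List ℕ} (h : Orb 0 e w v) :
    Join (ReflTransGen (SortStep e)) w v := by
  apply join_of_eqvGen (sortStep_wf e) fun a b c => sortStep_confluent
  induction h with
  | refl => exact .refl _
  | @tail b c _ h ih =>
    refine ih.trans _ _ _ ?_
    obtain ⟨j, -, hj, rfl⟩ := h
    rcases lt_trichotomy (b.count (j + 1)) (b.count j) with h | h | h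
    · exact .rel _ _ ⟨j, hj, h, rfl⟩
    · rw [cS_of_count_eq h.symm]
      exact .refl _
    · refine .symm _ _ (.rel _ _ ⟨j, hj, ?_, (cS_cS j b).symm⟩)
      rwa [cS_count_left, cS_count_right]

/-- An element of an orbit is determined by the multiplicities of its letters, i.e. stabilizers of
weights act trivially. -/
theorem Orb.eq_of_count {e : ℕ} {w v : List ℕ} (h : Orb 0 e w v)
    (hc : ∀ i < e, w.count i = v.count i) : w = v := by
  induction w using (sortStep_wf e).induction generalizing v with
  | _ w ih =>
    by_cases hw : ∃ j, j + 1 < e ∧ w.count (j + 1) < w.count j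
    · obtain ⟨j, hj, hlt⟩ := hw
      have h1 : Orb 0 e (cS j w) (cS j v) :=
        ((Orb.of_cS w (Nat.zero_le j) hj).symm.trans h).trans (Orb.of_cS v (Nat.zero_le j) hj)
      have := ih _ ⟨j, hj, hlt, rfl⟩ h1 fun i hi => ?_
      · rw [← cS_cS j w, this, cS_cS]
      · by_cases h1 : i = j
        · rw [h1, cS_count_left, cS_count_left, hc _ hj]
        by_cases h2 : i = j + 1
        · rw [h2, cS_count_right, cS_count_right, hc _ (by omega)]
        · rw [cS_count_of_ne _ h1 h2, cS_count_of_ne _ h1 h2, hc _ hi]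
    · obtain ⟨d, hd, hd'⟩ := h.join
      rcases ReflTransGen.cases_head hd with rfl | ⟨x, ⟨j, hj, hlt, -⟩, -⟩
      · rcases ReflTransGen.cases_head hd' with h | ⟨x, ⟨j, hj, hlt, -⟩, -⟩
        · exact h.symm
        · rw [← hc _ hj, ← hc j (by omega)] at hlt
          exact absurd ⟨j, hj, hlt⟩ hw
      · exact absurd ⟨j, hj, hlt⟩ hw

theorem exists_sorted (e : ℕ) (w : List ℕ) : ∃ v, ReflTransGen (SortStep e) w v ∧
    ∀ j, j + 1 < e → v.count j ≤ v.count (j + 1) := by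
  induction w using (sortStep_wf e).induction with
  | _ w ih =>
    by_cases hw : ∃ j, j + 1 < e ∧ w.count (j + 1) < w.count j
    · obtain ⟨j, hj, hlt⟩ := hw
      obtain ⟨v, hv, hs⟩ := ih _ ⟨j, hj, hlt, rfl⟩
      exact ⟨v, .head ⟨j, hj, hlt, rfl⟩ hv, hs⟩
    · push Not at hw
      exact ⟨w, .refl, hw⟩

theorem Orb.of_sort {e : ℕ} {w v : List ℕ} (h : ReflTransGen (SortStep e) w v) : Orb 0 e w v :=
  h.lift id fun _ _ ⟨j, h1, _, h3⟩ => ⟨j, Nat.zero_le j, h1, h3⟩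

end SLCrystal

namespace SLCrystal

open Relation

/-! ### Moves between orbits -/

/-- Words in the same orbit of the group generated by `s_0, …, s_{n-1}`. -/
def orbSetoid (n : ℕ) : Setoid (List ℕ) where
  r := Orb 0 (n + 1)
  iseqv := ⟨fun _ => .refl, fun h => h.symm, fun h h' => h.trans h'⟩

/-- The set of Weyl group orbits of words in the letters `0, …, n`. (Words may contain further
letters, on which the group does not act.) -/
def Orbit (n : ℕ) : Type := Quotient (orbSetoid n)

namespace Orbit

variable {n : ℕ}

/-- The orbit of a word. -/
def mk (n : ℕ) (w : List ℕ) : Orbit n := Quotient.mk (orbSetoid n) w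

theorem mk_eq_mk {w v : List ℕ} : mk n w = mk n v ↔ Orb 0 (n + 1) w v :=
  ⟨fun h => Quotient.exact h, fun h => Quotient.sound h⟩

theorem mk_cS {j : ℕ} (hj : j < n) (w : List ℕ) : mk n (cS j w) = mk n w :=
  mk_eq_mk.2 (Orb.of_cS w (Nat.zero_le j) (by omega)).symm

/-- The multiset of the multiplicities of the letters `0, …, n`; it does not depend on the element
of the orbit. -/
def content : Orbit n → Multiset ℕ :=
  Quotient.lift (fun w => (cnts 0 (n + 1) w : Multiset ℕ)) fun w v h => by
    have h : Orb 0 (0 + (n + 1)) w v := by rw [Nat.zero_add]; exact h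
    exact Quotient.sound h.cnts_perm.symm

theorem content_mk (w : List ℕ) : content (mk n w) = (cnts 0 (n + 1) w : Multiset ℕ) := rfl

theorem exists_of_content {O : Orbit n} {l : List ℕ} (h : O.content = l) :
    ∃ v, mk n v = O ∧ cnts 0 (n + 1) v = l := by
  induction O using Quotient.inductionOn with
  | _ w =>
    have hp : (cnts 0 (n + 1) w).Perm l := Quotient.exact h
    obtain ⟨v, hv, hc⟩ := exists_orb_of_perm hp (m := 0) (w := w) (by rw [length_cnts])
    rw [length_cnts] at hv hc
    rw [Nat.zero_add] at hv
    exact ⟨v, mk_eq_mk.2 hv.symm, hc⟩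

theorem card_content (O : Orbit n) : Multiset.card O.content = n + 1 := by
  induction O using Quotient.inductionOn with
  | _ w => exact length_cnts w 0 (n + 1)

theorem two_le_of_content {O : Orbit n} {a b c : ℕ} {R : Multiset ℕ}
    (h : O.content = a ::ₘ b ::ₘ c ::ₘ R) : 2 ≤ n := by
  have := O.card_content
  rw [h] at this
  simp only [Multiset.card_cons] at this
  omega

theorem one_le_of_content {O : Orbit n} {a b : ℕ} {R : Multiset ℕ}
    (h : O.content = a ::ₘ b ::ₘ R) : 1 ≤ n := by
  have := O.card_content
  rw [h] at this
  simp only [Multiset.card_cons] at this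
  omega

/-- The orbit `O'` arises from `O` by turning a letter which occurs `a` times into a letter which
occurs `b` times, with `f_0` applied to an element in which these letters are `0` and `1`. -/
def Move (a b : ℕ) (O O' : Orbit n) : Prop :=
  ∃ v v', mk n v = O ∧ mk n v' = O' ∧ v.count 0 = a ∧ v.count 1 = b ∧ cF 0 v = some v'

theorem cF_zero_count {w v : List ℕ} (h : cF 0 w = some v) :
    w.count 0 = v.count 0 + 1 ∧ v.count 1 = w.count 1 + 1 ∧
      ∀ k, 2 ≤ k → v.count k = w.count k := by
  obtain ⟨h0, h1, h2⟩ := cF_count h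
  exact ⟨h0, h1, fun k hk => h2 k (by omega) (by omega)⟩

theorem cF_zero_isSome {w : List ℕ} (h : w.count 1 < w.count 0) : ∃ v, cF 0 w = some v := by
  have := count_add_ceps 0 w
  rw [zero_add] at this
  exact cF_isSome (by omega)

/-- Elements of an orbit in which the letters `0` and `1` have the same multiplicities are related
by reflections which commute with `f_0`. -/
theorem orb_two_of_orb {v v' : List ℕ} (hn : 1 ≤ n) (h : Orb 0 (n + 1) v v')
    (h0 : v.count 0 = v'.count 0) (h1 : v.count 1 = v'.count 1) : Orb 2 (n + 1) v v' := by
  obtain ⟨n, rfl⟩ := Nat.exists_eq_add_of_le' hn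
  have hp : Orb 0 (0 + (n + 2)) v v' := by rw [Nat.zero_add]; exact h
  have hp := hp.cnts_perm.symm
  simp only [cnts_succ, h0, h1] at hp
  rw [List.perm_cons, List.perm_cons] at hp
  obtain ⟨u, hu, hc⟩ := exists_orb_of_perm hp (m := 2) (w := v) (by rw [length_cnts])
  rw [length_cnts] at hu hc
  rw [add_comm 2 n] at hu
  suffices u = v' by rw [← this]; exact hu
  refine Orb.eq_of_count ((hu.mono (Nat.zero_le 2) le_rfl).symm.trans h) fun i hi => ?_
  by_cases h2 : i < 2
  · rw [hu.count_of_lt (Or.inl h2)]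
    obtain rfl | rfl : i = 0 ∨ i = 1 := by omega
    · exact h0
    · exact h1
  · exact count_eq_of_cnts_eq hc i (by omega) (by omega)

theorem orb_two_cF {e : ℕ} {v v' u u' : List ℕ} (h : Orb 2 e v v') (hu : cF 0 v = some u)
    (hu' : cF 0 v' = some u') : Orb 2 e u u' := by
  induction h generalizing u' with
  | refl => rw [Option.some.inj (hu.symm.trans hu')]; exact .refl
  | @tail b c _ h ih =>
    obtain ⟨j, hj, he, rfl⟩ := h
    have h1 := cS_far_cF (i := j) (j := 0) (Or.inr (by omega)) hu'
    rw [cS_cS] at h1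
    exact (ih h1).tail ⟨j, hj, he, (cS_cS j u').symm⟩

/-- The target of a move is determined by its source and the two multiplicities. -/
theorem Move.functional {a b : ℕ} {O O₁ O₂ : Orbit n} (hn : 1 ≤ n) (h₁ : Move a b O O₁)
    (h₂ : Move a b O O₂) : O₁ = O₂ := by
  obtain ⟨v, u, rfl, rfl, h0, h1, hu⟩ := h₁
  obtain ⟨v', u', h, rfl, h0', h1', hu'⟩ := h₂
  have := orb_two_of_orb hn (mk_eq_mk.1 h) (h0'.trans h0.symm) (h1'.trans h1.symm)
  exact mk_eq_mk.2 ((orb_two_cF this hu' hu).mono (Nat.zero_le 2) le_rfl).symm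

theorem exists_cF_of_orb_two {e : ℕ} {v u u' : List ℕ} (h : Orb 2 e u u')
    (hu : cF 0 v = some u) : ∃ v', Orb 2 e v v' ∧ cF 0 v' = some u' := by
  induction h with
  | refl => exact ⟨v, .refl, hu⟩
  | @tail b c _ h ih =>
    obtain ⟨j, hj, he, rfl⟩ := h
    obtain ⟨v', hv, hv'⟩ := ih
    exact ⟨cS j v', hv.tail ⟨j, hj, he, rfl⟩, cS_far_cF (i := j) (j := 0) (Or.inr (by omega)) hv'⟩

theorem Move.injective {a b : ℕ} {O O₁ O₂ : Orbit n} (hn : 1 ≤ n) (h₁ : Move a b O₁ O)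
    (h₂ : Move a b O₂ O) : O₁ = O₂ := by
  obtain ⟨v, u, rfl, rfl, h0, h1, hu⟩ := h₁
  obtain ⟨v', u', rfl, h, h0', h1', hu'⟩ := h₂
  have c := cF_zero_count hu
  have c' := cF_zero_count hu'
  have := orb_two_of_orb hn (mk_eq_mk.1 h) (by omega) (by omega)
  obtain ⟨v'', h2, hv''⟩ := exists_cF_of_orb_two this hu'
  rw [← cF_inj hv'' hu]
  exact mk_eq_mk.2 (h2.mono (Nat.zero_le 2) le_rfl).symm

theorem Move.content {a b : ℕ} {O O' : Orbit n} {R : Multiset ℕ} (h : Move a b O O')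
    (hO : O.content = a ::ₘ b ::ₘ R) : ∃ a', a = a' + 1 ∧ O'.content = a' ::ₘ (b + 1) ::ₘ R := by
  obtain ⟨n, rfl⟩ := Nat.exists_eq_add_of_le' (one_le_of_content hO)
  obtain ⟨v, u, rfl, rfl, h0, h1, hu⟩ := h
  have c := cF_zero_count hu
  refine ⟨u.count 0, by omega, ?_⟩
  rw [content_mk, cnts_succ, cnts_succ] at hO ⊢
  rw [h0, h1, ← Multiset.cons_coe, ← Multiset.cons_coe, Multiset.cons_inj_right,
    Multiset.cons_inj_right] at hO
  rw [← hO, cnts_congr (w := u) (v := v) fun i h1 h2 => c.2.2 i (by omega)]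
  rw [← Multiset.cons_coe, ← Multiset.cons_coe, c.2.1, h1]

theorem Move.content_source {a b : ℕ} {O O' : Orbit n} {R : Multiset ℕ}
    (h : Move (a + 1) b O O') (hO : O'.content = a ::ₘ (b + 1) ::ₘ R) :
    O.content = (a + 1) ::ₘ b ::ₘ R := by
  obtain ⟨n, rfl⟩ := Nat.exists_eq_add_of_le' (one_le_of_content hO)
  obtain ⟨v, u, rfl, rfl, h0, h1, hu⟩ := h
  have c := cF_zero_count hu
  rw [content_mk, cnts_succ, cnts_succ] at hO ⊢
  have h0' : u.count 0 = a := by omega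
  have h1' : u.count (0 + 1) = b + 1 := by rw [zero_add]; omega
  rw [h0', h1', ← Multiset.cons_coe, ← Multiset.cons_coe, Multiset.cons_inj_right,
    Multiset.cons_inj_right] at hO
  rw [← hO, cnts_congr (w := u) (v := v) fun i h1 h2 => c.2.2 i (by omega)]
  rw [← Multiset.cons_coe, ← Multiset.cons_coe, h0, zero_add, h1]

theorem exists_move {a b : ℕ} {O : Orbit n} {R : Multiset ℕ} (hO : O.content = a ::ₘ b ::ₘ R)
    (hab : b < a) : ∃ O', Move a b O O' := by
  obtain ⟨n, rfl⟩ := Nat.exists_eq_add_of_le' (one_le_of_content hO)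
  obtain ⟨v, rfl, hv⟩ := exists_of_content (O := O) (l := a :: b :: R.toList)
    (by simp [hO, ← Multiset.cons_coe])
  simp only [cnts_succ, List.cons.injEq] at hv
  have h1 : v.count 1 = b := hv.2.1
  obtain ⟨u, hu⟩ := cF_zero_isSome (w := v) (by omega)
  exact ⟨mk _ u, v, u, rfl, rfl, hv.1, h1, hu⟩

/-- The orbit `O` has multiplicities `a, b, c` and the remaining multiset `R`, and an element in
which `a, b, c` are the multiplicities of the letters `0, 1, 2` has the key `k`. This element is
unique only up to reflections of the letters `3, …, n`, so `k` is not determined by the other data.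
-/
def HasKey (a b c : ℕ) (R : Multiset ℕ) (k : Key) (O : Orbit n) : Prop :=
  O.content = a ::ₘ b ::ₘ c ::ₘ R ∧
    ∃ v, mk n v = O ∧ v.count 0 = a ∧ v.count 1 = b ∧ v.count 2 = c ∧ key 0 v = k

variable {a b c d : ℕ} {R : Multiset ℕ} {k : Key} {O O' : Orbit n}

theorem exists_hasKey (h : O.content = a ::ₘ b ::ₘ c ::ₘ R) : ∃ k, HasKey a b c R k O := by
  obtain ⟨n, rfl⟩ := Nat.exists_eq_add_of_le' (two_le_of_content h)
  obtain ⟨v, hv, hc⟩ := exists_of_content (O := O) (l := a :: b :: c :: R.toList)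
    (by simp [h, ← Multiset.cons_coe])
  simp only [cnts_succ, List.cons.injEq] at hc
  exact ⟨_, h, v, hv, hc.1, hc.2.1, hc.2.2.1, rfl⟩

/-- Exchanging the roles of two multiplicities `c ≥ d` does not raise the level of the key. -/
theorem exists_hasKey_pair (h : O.content = a ::ₘ b ::ₘ c ::ₘ d ::ₘ R) (hdc : d ≤ c) :
    ∃ k k' : Key, HasKey a b c (d ::ₘ R) k O ∧ HasKey a b d (c ::ₘ R) k' O ∧ k'.2.1 ≤ k.2.1 := by
  have hn : 3 ≤ n := by
    have := O.card_content
    rw [h] at this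
    simp only [Multiset.card_cons] at this
    omega
  obtain ⟨n, rfl⟩ := Nat.exists_eq_add_of_le' hn
  obtain ⟨v, hv, hc⟩ := exists_of_content (O := O) (l := a :: b :: c :: d :: R.toList)
    (by simp [h, ← Multiset.cons_coe])
  simp only [cnts_succ, List.cons.injEq] at hc
  obtain ⟨h0, h1, h2, h3, -⟩ := hc
  refine ⟨_, _, ⟨h, v, hv, h0, h1, h2, rfl⟩, ⟨?_, cS 2 v, ?_, ?_, ?_, ?_, rfl⟩, ?_⟩
  · rw [h, Multiset.cons_swap c d]
  · rw [mk_cS (by omega), hv]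
  · rw [cS_count_of_ne _ (by omega) (by omega), h0]
  · rw [cS_count_of_ne _ (by omega) (by omega), h1]
  · rw [cS_count_left]; exact h3
  · exact level_cS_le (i := 0) (by simpa [h2] using h3.trans_le hdc)

theorem HasKey.swap₁ (h : HasKey a b c R k O) : HasKey b a c R k O := by
  have hn := two_le_of_content h.1
  obtain ⟨hc, v, rfl, rfl, rfl, rfl, rfl⟩ := h
  exact ⟨by rw [hc, Multiset.cons_swap], cS 0 v, mk_cS (by omega) v, cS_count_left 0 v,
    cS_count_right 0 v, cS_count_of_ne v (by omega) (by omega), key_cS_fst 0 v⟩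

theorem HasKey.swap₂ (h : HasKey a b c R k O) : HasKey a c b R k O := by
  have hn := two_le_of_content h.1
  obtain ⟨hc, v, rfl, rfl, rfl, rfl, rfl⟩ := h
  exact ⟨by rw [hc, Multiset.cons_swap (v.count 1)], cS 1 v, mk_cS (by omega) v,
    cS_count_of_ne v (by omega) (by omega), cS_count_left 1 v, cS_count_right 1 v, key_cS_snd 0 v⟩

theorem HasKey.rotl (h : HasKey a b c R k O) : HasKey b c a R k O := h.swap₁.swap₂

theorem HasKey.rotr (h : HasKey a b c R k O) : HasKey c a b R k O := h.swap₂.swap₁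

theorem HasKey.swap₁₃ (h : HasKey a b c R k O) : HasKey c b a R k O := h.rotl.swap₁

/-- The key and the multiplicities determine the orbit. -/
theorem HasKey.eq (h : HasKey a b c R k O) (h' : HasKey a b c R k O') : O = O' := by
  obtain ⟨-, v, rfl, h0, h1, -, rfl⟩ := h
  obtain ⟨-, v', rfl, h0', h1', -, hk⟩ := h'
  rw [eq_of_key_eq (i := 0) hk.symm (h0.trans h0'.symm) (h1.trans h1'.symm)]

theorem HasKey.of_move (h : HasKey (a + 1) b c R k O) (hab : b ≤ a) (hm : Move (a + 1) b O O') :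
    HasKey a (b + 1) c R k O' := by
  have hn := two_le_of_content h.1
  obtain ⟨a', ha, hc'⟩ := hm.content h.1
  obtain rfl : a = a' := by omega
  refine ⟨hc', ?_⟩
  obtain ⟨hc, v, rfl, h0, h1, h2, rfl⟩ := h
  obtain ⟨u, hu⟩ := cF_zero_isSome (w := v) (by omega)
  have hcu := cF_zero_count hu
  refine ⟨u, Move.functional (by omega) ⟨v, u, rfl, rfl, h0, h1, hu⟩ hm, by omega, by omega, ?_,
    key_str (.of_cF hu)⟩
  rw [hcu.2.2 2 le_rfl, h2]

theorem HasKey.of_raise (h : HasKey a (b + 1) c R k O) (hm : Move (a + 1) b O' O) :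
    HasKey (a + 1) b c R k O' := by
  have hn := two_le_of_content h.1
  refine ⟨hm.content_source h.1, ?_⟩
  obtain ⟨hc, u, rfl, h0, h1, h2, rfl⟩ := h
  obtain ⟨v', u', rfl, h', h0', h1', hu'⟩ := hm
  have hcu := cF_zero_count hu'
  have := orb_two_of_orb (by omega) (mk_eq_mk.1 h') (by omega) (by omega)
  obtain ⟨v, hv, hu⟩ := exists_cF_of_orb_two this hu'
  have hcu' := cF_zero_count hu
  refine ⟨v, mk_eq_mk.2 (hv.mono (Nat.zero_le 2) le_rfl).symm, by omega, by omega, ?_,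
    (key_str (.of_cF hu)).symm⟩
  rw [← hcu'.2.2 2 le_rfl, h2]

theorem HasKey.exists_move (h : HasKey (a + 1) b c R k O) (hab : b ≤ a) :
    ∃ O', Move (a + 1) b O O' ∧ HasKey a (b + 1) c R k O' := by
  obtain ⟨O', hO'⟩ := Orbit.exists_move h.1 (by omega)
  exact ⟨O', hO', h.of_move hab hO'⟩

theorem HasKey.move (h : HasKey (a + 1) b c R k O) (h' : HasKey a (b + 1) c R k O')
    (hab : b ≤ a) : Move (a + 1) b O O' := by
  obtain ⟨O'', hm, hk⟩ := h.exists_move hab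
  rwa [h'.eq hk]

/-- Whether an orbit is the target of a move is decided by the numerical part of its key. -/
theorem HasKey.exists_raise_iff (h : HasKey a (b + 1) c R k O) :
    (∃ O' : Orbit n, HasKey (a + 1) b c R k O') ↔ k.2.2 < b + 1 + min k.2.1 c := by
  obtain ⟨hc, v, hv, h0, h1, h2, rfl⟩ := h
  have := ceps_pos_iff 0 v
  rw [zero_add, zero_add, h1, h2] at this
  rw [← this]
  constructor
  · rintro ⟨O', -, v', -, h0', h1', h2', hk⟩
    rw [this, ← hk]
    have := tab_stats 0 v'
    obtain ⟨-, -, b2, b3, -⟩ := this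
    simp only [key, level, Tab.invariant]
    rw [zero_add] at b2 b3
    omega
  · intro h
    obtain ⟨u, hu⟩ := cE_isSome h
    rw [← cF_iff_cE] at hu
    have hcu := cF_zero_count hu
    have hk := key_str (Str.of_cF hu)
    have e1 : u.count 0 = a + 1 := by omega
    have e2 : u.count 1 = b := by omega
    have e3 : u.count 2 = c := by rw [← hcu.2.2 2 le_rfl, h2]
    refine ⟨mk n u, ?_, u, rfl, e1, e2, e3, hk.symm⟩
    obtain ⟨n, rfl⟩ := Nat.exists_eq_add_of_le' (two_le_of_content hc)
    rw [← hv] at hc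
    rw [content_mk, cnts_succ, cnts_succ, cnts_succ] at hc ⊢
    rw [h0, h1, h2] at hc
    rw [e1, e2, e3, cnts_congr (w := u) (v := v)
      fun i h1 h2 => (hcu.2.2 i (by omega)).symm]
    simp only [← Multiset.cons_coe, Multiset.cons_inj_right] at hc ⊢
    exact hc

end Orbit

end SLCrystal

namespace SLCrystal

open Relation

namespace Orbit

variable {n : ℕ}

/-! ### Confluence of moves -/

/-- A move between a letter that occurs `a + 1` times and one that occurs `b < a` times, so that
the content becomes more balanced. In terms of dominant weights, it subtracts a positive root. -/
def Down (O O' : Orbit n) : Prop :=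
  ∃ a b R, O.content = (a + 1) ::ₘ b ::ₘ R ∧ b + 1 ≤ a ∧ Move (a + 1) b O O'

variable {a b c d : ℕ} {R : Multiset ℕ} {k : Key} {O O' O₁ O₂ : Orbit n}

/-- A move with fixed key is a `Down` relation, or trivial if it merely exchanges the two
multiplicities. -/
theorem HasKey.down (h : HasKey (a + 1) b c R k O) (h' : HasKey a (b + 1) c R k O')
    (hab : b ≤ a) : ReflTransGen Down O O' := by
  rcases hab.eq_or_lt with rfl | hab'
  · rw [h.swap₁.eq h']
  · exact .single ⟨a, b, _, h.1, hab', h.move h' hab⟩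

/-- With fixed key, three multiplicities can be lowered until they differ by at most one. The
number `N` serves for induction. -/
theorem HasKey.exists_balanced : ∀ (N a b c : ℕ), a ^ 2 + b ^ 2 + c ^ 2 ≤ N → ∀ {O : Orbit n},
    HasKey a b c R k O → ∃ O' p q r, ReflTransGen Down O O' ∧ HasKey p q r R k O' ∧
      p ≤ q ∧ q ≤ r ∧ r ≤ p + 1 ∧ p + q + r = a + b + c := by
  intro N
  induction N with
  | zero =>
    intro a b c hN O h
    have h1 : a ^ 2 = 0 ∧ b ^ 2 = 0 ∧ c ^ 2 = 0 := by omega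
    simp only [ne_eq, OfNat.ofNat_ne_zero, not_false_eq_true, pow_eq_zero_iff] at h1
    obtain ⟨rfl, rfl, rfl⟩ := h1
    exact ⟨O, 0, 0, 0, .refl, h, by omega⟩
  | succ N ih =>
    have step : ∀ a b c, (a + 1) ^ 2 + b ^ 2 + c ^ 2 ≤ N + 1 → b + 1 ≤ a → ∀ {O : Orbit n},
        HasKey (a + 1) b c R k O → ∃ O' p q r, ReflTransGen Down O O' ∧ HasKey p q r R k O' ∧
          p ≤ q ∧ q ≤ r ∧ r ≤ p + 1 ∧ p + q + r = (a + 1) + b + c := by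
      intro a b c hN hab O h
      obtain ⟨O₁, -, h₁⟩ := h.exists_move (by omega : b ≤ a)
      obtain ⟨O', p, q, r, h2, h3, h4, h5, h6, h7⟩ := ih a (b + 1) c (by nlinarith) h₁
      exact ⟨O', p, q, r, (h.down h₁ (by omega)).trans h2, h3, h4, h5, h6, by omega⟩
    have sorted : ∀ a b c, a ^ 2 + b ^ 2 + c ^ 2 ≤ N + 1 → a ≤ b → b ≤ c → ∀ {O : Orbit n},
        HasKey a b c R k O → ∃ O' p q r, ReflTransGen Down O O' ∧ HasKey p q r R k O' ∧
          p ≤ q ∧ q ≤ r ∧ r ≤ p + 1 ∧ p + q + r = a + b + c := by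
      intro a b c hN hab hbc O h
      by_cases hac : c ≤ a + 1
      · exact ⟨O, a, b, c, .refl, h, hab, hbc, hac, rfl⟩
      · obtain ⟨c, rfl⟩ := Nat.exists_eq_add_of_lt (Nat.zero_lt_of_lt (not_le.1 hac))
        rw [zero_add] at *
        obtain ⟨O', p, q, r, h2, h3, h4, h5, h6, h7⟩ :=
          step c a b (by omega) (by omega) h.swap₂.swap₁
        exact ⟨O', p, q, r, h2, h3, h4, h5, h6, by omega⟩
    intro a b c hN O h
    rcases le_total a b with h1 | h1 <;> rcases le_total b c with h2 | h2 <;>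
      rcases le_total a c with h3 | h3
    · exact sorted a b c hN h1 h2 h
    · exact sorted a b c hN h1 h2 h
    · simpa only [add_right_comm] using sorted a c b (by omega) h3 h2 h.swap₂
    · have := sorted c a b (by omega) h3 h1 h.swap₂.swap₁
      rwa [show c + a + b = a + b + c by ring] at this
    · have := sorted b a c (by omega) h1 h3 h.swap₁
      rwa [add_comm b a] at this
    · have := sorted b c a (by omega) h2 h3 h.swap₁.swap₂
      rwa [show b + c + a = a + b + c by ring] at this
    · have := sorted c b a (by omega) h2 h1 h.swap₁.swap₂.swap₁
      rwa [show c + b + a = a + b + c by ring] at this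
    · have := sorted c b a (by omega) h2 h1 h.swap₁.swap₂.swap₁
      rwa [show c + b + a = a + b + c by ring] at this

/-- Two orbits with the same key and the same sum of the three multiplicities have a common
balanced lower bound, since this is determined by the key. -/
theorem HasKey.join_down {a' b' c' : ℕ} (h : HasKey a b c R k O) (h' : HasKey a' b' c' R k O')
    (hs : a + b + c = a' + b' + c') : Join (ReflTransGen Down) O O' := by
  obtain ⟨P, p, q, r, h1, h2, h3, h4, h5, h6⟩ := HasKey.exists_balanced _ a b c le_rfl h
  obtain ⟨P', p', q', r', h1', h2', h3', h4', h5', h6'⟩ :=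
    HasKey.exists_balanced _ a' b' c' le_rfl h'
  obtain ⟨rfl, rfl, rfl⟩ : p = p' ∧ q = q' ∧ r = r' := by omega
  exact ⟨P, h1, by rwa [h2.eq h2']⟩

/-- The case of two moves between four different letters. The move between the largest and the
smallest multiplicities available produces an orbit `U`, from which both moves are completed by
keys on three letters. -/
theorem join_down_four (h : O.content = (a + 1) ::ₘ b ::ₘ (c + 1) ::ₘ d ::ₘ R) (hab : b + 1 ≤ a)
    (hcd : d + 1 ≤ c) (hca : c ≤ a) (h₁ : Move (a + 1) b O O₁) (h₂ : Move (c + 1) d O O₂) :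
    Join (ReflTransGen Down) O₁ O₂ := by
  obtain ⟨k₁, K₁⟩ := exists_hasKey (a := a + 1) (b := b) (c := d) (R := (c + 1) ::ₘ R) (O := O)
    (by simp only [h, Multiset.cons_swap])
  obtain ⟨k₂, K₂⟩ := exists_hasKey (a := a + 1) (b := c + 1) (c := d) (R := b ::ₘ R) (O := O)
    (by simp only [h, Multiset.cons_swap])
  have K₁' := K₁.of_move (by omega) h₁
  have K₂' := K₂.rotl.of_move (by omega) h₂
  -- `U` is the target of the move from `a + 1` to `d`.
  obtain ⟨U, hU, KU₁⟩ := K₁.swap₂.exists_move (by omega)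
  have KU₂ := K₂.swap₂.of_move (by omega) hU
  rcases Nat.lt_or_ge b d with hbd | hbd
  · obtain ⟨k₃, K₃⟩ := exists_hasKey (a := c + 1) (b := b) (c := d + 1) (R := a ::ₘ R) (O := U)
      (by simp only [KU₁.1, Multiset.cons_swap])
    obtain ⟨Y, hY, KY⟩ := K₃.exists_move (by omega)
    have m₁ : Move (d + 1) b U O₁ := KU₁.rotl.move K₁'.swap₁₃ hbd.le
    have KO₁ := K₃.swap₁₃.of_move hbd.le m₁
    obtain ⟨V, hV, KV⟩ := K₂'.swap₁₃.exists_move (by omega)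
    have m₂ : Move (c + 1) (d + 1) U V := KU₂.swap₁₃.move KV.swap₁₃ (by omega)
    have KV₃ := K₃.swap₂.of_move (by omega) m₂
    exact ⟨Y, KO₁.rotr.down KY.swap₂ (by omega),
      (K₂'.swap₁₃.down KV (by omega)).trans (KV₃.rotl.down KY.swap₁₃ (by omega))⟩
  · exact ⟨U, K₁'.rotl.down KU₁.swap₁₃ hbd, K₂'.rotr.down KU₂.swap₂ hca⟩

/-- Two moves out of one orbit can be completed to a common lower bound. If the moves share a
letter, this is `HasKey.join_down`. -/
theorem down_confluent (h₁ : Down O O₁) (h₂ : Down O O₂) : Join (ReflTransGen Down) O₁ O₂ := by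
  obtain ⟨a, b, R, hO, hab, m₁⟩ := h₁
  obtain ⟨c, d, R', hO', hcd, m₂⟩ := h₂
  have hn := one_le_of_content hO
  have hR := hO.symm.trans hO'
  by_cases hac : a = c
  · subst hac
    rw [Multiset.cons_inj_right] at hR
    rcases Multiset.cons_eq_cons.1 hR with ⟨rfl, rfl⟩ | ⟨hne, S, rfl, rfl⟩
    · rw [m₁.functional hn m₂]
      exact ⟨_, .refl, .refl⟩
    · obtain ⟨k, K⟩ := exists_hasKey hO
      exact (K.of_move (by omega) m₁).join_down (K.swap₂.of_move (by omega) m₂) (by omega)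
  by_cases hbd : b = d
  · subst hbd
    rw [Multiset.cons_swap, Multiset.cons_swap (c + 1), Multiset.cons_inj_right] at hR
    rcases Multiset.cons_eq_cons.1 hR with ⟨h, rfl⟩ | ⟨hne, S, rfl, rfl⟩
    · omega
    · obtain ⟨k, K⟩ := exists_hasKey hO
      exact (K.of_move (by omega) m₁).join_down (K.rotr.swap₂.of_move (by omega) m₂) (by omega)
  rcases Multiset.cons_eq_cons.1 hR with ⟨h, -⟩ | ⟨-, S, hS, hS'⟩
  · omega
  rcases Multiset.cons_eq_cons.1 hS with ⟨rfl, rfl⟩ | ⟨hbc, S₁, rfl, rfl⟩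
  · -- the target of the first move is the source of the second
    rcases Multiset.cons_eq_cons.1 hS' with ⟨h, -⟩ | ⟨-, S₂, rfl, rfl⟩
    · omega
    · obtain ⟨k, K⟩ := exists_hasKey (hO.trans rfl)
      exact (K.of_move (by omega) m₁).join_down (K.rotl.of_move (by omega) m₂) (by omega)
  · rcases Multiset.cons_eq_cons.1 hS' with ⟨rfl, -⟩ | ⟨-, S₂, rfl, hS₂⟩
    · obtain ⟨k, K⟩ := exists_hasKey hO
      exact (K.of_move (by omega) m₁).join_down (K.rotr.of_move (by omega) m₂)
        (by omega)
    · rcases Multiset.cons_eq_cons.1 hS₂ with ⟨h, -⟩ | ⟨-, S₃, rfl, rfl⟩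
      · omega
      · rcases le_total c a with hca | hca
        · exact join_down_four hO hab hcd hca m₁ m₂
        · obtain ⟨Y, h, h'⟩ := join_down_four (O := O) (a := c) (b := d) (c := a) (d := b) (R := S₃)
            (by simp only [hO, Multiset.cons_swap]) hcd hab hca m₂ m₁
          exact ⟨Y, h', h⟩

/-- With fixed key, if `x` can be raised at the expense of `y + 1`, and `y + 1` at the expense of
`z + 1`, then `x` can be raised at the expense of `z + 1`. -/
theorem HasKey.exists_raise {x y z : ℕ}
    (h : HasKey x (y + 1) (z + 1) R k O) (h₁ : HasKey (x + 1) y (z + 1) R k O₁)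
    (h₂ : HasKey x (y + 2) z R k O₂) : ∃ X : Orbit n, HasKey (x + 1) (y + 1) z R k X := by
  have e₁ := h.exists_raise_iff.1 ⟨O₁, h₁⟩
  have e₂ := h.rotl.exists_raise_iff.1 ⟨O₂, h₂.rotl⟩
  obtain ⟨X, hX⟩ := h.swap₂.exists_raise_iff.2 (by omega)
  exact ⟨X, hX.swap₂⟩

/-- Two inverse moves with four different letters such that the interval `[d, c]` lies inside
`[b, a]`: the outer one leads higher. -/
theorem down_of_nested (h : O.content = a ::ₘ (b + 1) ::ₘ c ::ₘ (d + 1) ::ₘ R)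
    (hca : c ≤ a) (hbd : b ≤ d) (hdc : d + 1 ≤ c) (m₁ : Move (a + 1) b O₁ O)
    (m₂ : Move (c + 1) d O₂ O) : ReflTransGen Down O₁ O₂ := by
  obtain ⟨k₁, K₁⟩ := exists_hasKey (a := a) (b := b + 1) (c := c) (R := (d + 1) ::ₘ R) (O := O)
    (by simp only [h, Multiset.cons_swap])
  obtain ⟨k₂, K₂⟩ := exists_hasKey (a := c) (b := d + 1) (c := b + 1) (R := a ::ₘ R) (O := O)
    (by simp only [h, Multiset.cons_swap])
  have K₁' := K₁.of_raise m₁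
  have K₂' := K₂.of_raise m₂
  obtain ⟨Z, -, KZ⟩ := K₁'.swap₂.exists_move (by omega)
  have mZ : Move (c + 1) b Z O := KZ.rotl.move K₁.swap₁₃ (by omega)
  have KZ₂ := K₂.swap₂.of_raise mZ
  exact (K₁'.swap₂.down KZ hca).trans (KZ₂.rotr.swap₂.down K₂'.rotl hbd)

/-- Two inverse moves with four different letters whose intervals `[b, a]` and `[d, c]` overlap:
the inverse move between the extreme multiplicities `a` and `d + 1` gives a common upper bound. -/
theorem join_up_of_interleaved (h : O.content = a ::ₘ (b + 1) ::ₘ c ::ₘ (d + 1) ::ₘ R)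
    (hca : c ≤ a) (hdb : d ≤ b) (hbc : b + 1 ≤ c) (m₁ : Move (a + 1) b O₁ O)
    (m₂ : Move (c + 1) d O₂ O) :
    ∃ X, ReflTransGen Down X O₁ ∧ ReflTransGen Down X O₂ := by
  obtain ⟨k₂, K₂⟩ := exists_hasKey (a := c) (b := d + 1) (c := b + 1) (R := a ::ₘ R) (O := O)
    (by simp only [h, Multiset.cons_swap])
  obtain ⟨k₁, K₁⟩ := exists_hasKey (a := a) (b := b + 1) (c := d + 1) (R := c ::ₘ R) (O := O)
    (by simp only [h, Multiset.cons_swap])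
  obtain ⟨k₃, K₃⟩ := exists_hasKey (a := a) (b := d + 1) (c := c) (R := (b + 1) ::ₘ R) (O := O)
    (by simp only [h, Multiset.cons_swap])
  have K₂' := K₂.of_raise m₂
  obtain ⟨W, -, KW⟩ := K₂'.swap₂.exists_move hbc
  have mW : Move (b + 1 + 1) d W O := KW.rotl.move K₂.swap₁₃ (by omega)
  have K₁' := K₁.of_raise m₁
  have KW₁ := K₁.rotl.of_raise mW
  obtain ⟨X, KX⟩ := K₁.exists_raise K₁' KW₁.rotr
  have mX : Move (a + 1) d X O := KX.swap₂.move K₁.swap₂ (by omega)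
  have KX₃ := K₃.of_raise mX
  have K₃' := K₃.swap₁₃.of_raise m₂
  exact ⟨X, KX.rotl.down K₁'.rotl hdb, KX₃.swap₂.down K₃'.rotr hca⟩

/-- Two inverse moves with four different letters whose intervals `[d, c]` and `[b, a]` lie apart
from each other. The move from `b + 1` to `c` leads to an orbit `T`, in which the inverse moves
become two with overlapping intervals. -/
theorem join_up_of_separated (h : O.content = a ::ₘ (b + 1) ::ₘ c ::ₘ (d + 1) ::ₘ R)
    (hba : b + 1 ≤ a) (hcb : c + 1 ≤ b) (hdc : d + 1 ≤ c) (m₁ : Move (a + 1) b O₁ O)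
    (m₂ : Move (c + 1) d O₂ O) :
    ∃ X, ReflTransGen Down X O₁ ∧ ReflTransGen Down X O₂ := by
  obtain ⟨k₁, K₁⟩ := exists_hasKey (a := a) (b := b + 1) (c := c) (R := (d + 1) ::ₘ R) (O := O)
    (by simp only [h, Multiset.cons_swap])
  obtain ⟨k₂, K₂⟩ := exists_hasKey (a := b + 1) (b := c) (c := d + 1) (R := a ::ₘ R) (O := O)
    (by simp only [h, Multiset.cons_swap])
  have K₁' := K₁.of_raise m₁
  obtain ⟨T, mT, KT⟩ := K₁.rotl.exists_move (by omega)
  have mO₁ : Move (a + 1) c O₁ T := K₁'.swap₂.move KT.swap₁₃ (by omega)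
  have KT₂ := K₂.of_move (by omega) mT
  have K₂' := K₂.rotl.of_raise m₂
  have mO₂ : Move (b + 1) d O₂ T := K₂'.swap₁₃.move KT₂.swap₂ (by omega)
  obtain ⟨W, -, KW⟩ := K₂'.rotr.exists_move hcb
  have mW : Move (c + 1 + 1) d W T := KW.rotl.move KT₂.rotl (by omega)
  obtain ⟨k₃, K₃⟩ := exists_hasKey (a := a) (b := c + 1) (c := d + 1) (R := b ::ₘ R) (O := T)
    (by simp only [KT.1, Multiset.cons_swap])
  obtain ⟨k₄, K₄⟩ := exists_hasKey (a := a) (b := d + 1) (c := b) (R := (c + 1) ::ₘ R) (O := T)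
    (by simp only [KT.1, Multiset.cons_swap])
  have K₃' := K₃.of_raise mO₁
  obtain ⟨X, KX⟩ := K₃.exists_raise K₃' (K₃.rotl.of_raise mW).rotr
  have mX : Move (a + 1) d X T := KX.swap₂.move K₃.swap₂ (by omega)
  have KX₄ := K₄.of_raise mX
  have K₄' := K₄.swap₁₃.of_raise mO₂
  exact ⟨X, KX.rotl.down K₃'.rotl (by omega), KX₄.swap₂.down K₄'.rotr (by omega)⟩

/-- The remaining position of the intervals, in which `[d, c]` and `[c, a]` touch. The triples
`c + 1, c, a` and `c + 1, c, d + 1` have keys whose levels are comparable; this shows that the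
letter occurring `c + 1` times can be raised at the expense of the one occurring `d + 1` times, or
that occurring `a` times at the expense of the one occurring `c` times. Either suffices. -/
theorem join_up_of_adjacent (h : O.content = a ::ₘ (c + 1) ::ₘ c ::ₘ (d + 1) ::ₘ R)
    (hca : c + 1 ≤ a) (hdc : d + 1 ≤ c) (m₁ : Move (a + 1) c O₁ O)
    (m₂ : Move (c + 1) d O₂ O) :
    ∃ X, ReflTransGen Down X O₁ ∧ ReflTransGen Down X O₂ := by
  obtain ⟨k, k', K, K', hkk⟩ := exists_hasKey_pair (a := c + 1) (b := c) (c := a) (d := d + 1)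
    (R := R) (O := O) (by simp only [h, Multiset.cons_swap]) (by omega)
  obtain ⟨k₅, K₅⟩ := exists_hasKey (a := a) (b := c) (c := d + 1) (R := (c + 1) ::ₘ R) (O := O)
    (by simp only [h, Multiset.cons_swap])
  obtain ⟨k₆, K₆⟩ := exists_hasKey (a := a) (b := c + 1) (c := d + 1) (R := c ::ₘ R) (O := O)
    (by simp only [h, Multiset.cons_swap])
  have K₆' := K₆.of_raise m₁
  have K₅' := K₅.rotl.of_raise m₂
  have hX : ∃ X, Move (a + 1) d X O := by
    have i₁ := K.rotr.exists_raise_iff.1 ⟨O₁, K.rotr.of_raise m₁⟩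
    have i₂ := K'.rotl.exists_raise_iff.1 ⟨O₂, K'.rotl.of_raise m₂⟩
    by_cases hE : k'.2.2 < d + 1 + min k'.2.1 c
    · obtain ⟨W, KW⟩ := K'.swap₂.exists_raise_iff.2 hE
      have mW : Move (c + 1 + 1) d W O := KW.move K'.swap₂ (by omega)
      obtain ⟨X, KX⟩ := K₆.exists_raise K₆' (K₆.rotl.of_raise mW).rotr
      exact ⟨X, KX.swap₂.move K₆.swap₂ (by omega)⟩
    · obtain ⟨c, rfl⟩ := Nat.exists_eq_add_of_le' (Nat.one_le_of_lt hdc)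
      obtain ⟨W, KW⟩ := K.swap₁₃.exists_raise_iff.2 (by omega)
      have mW : Move (a + 1) c W O := KW.move K.swap₁₃ (by omega)
      obtain ⟨X, KX⟩ := K₅.exists_raise (K₅.of_raise mW) K₅'.rotr
      exact ⟨X, KX.swap₂.move K₅.swap₂ (by omega)⟩
  obtain ⟨X, mX⟩ := hX
  have KX₅ := K₅.swap₂.of_raise mX
  have KX₆ := K₆.swap₂.of_raise mX
  exact ⟨X, KX₆.swap₁₃.down K₆'.rotl (by omega), KX₅.swap₂.down K₅'.rotr (by omega)⟩

/-- Two inverse moves out of one orbit can be completed to a common upper bound. -/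
theorem up_confluent (h₁ : Down O₁ O) (h₂ : Down O₂ O) :
    ∃ X, ReflTransGen Down X O₁ ∧ ReflTransGen Down X O₂ := by
  have main : ∀ {a b c d : ℕ} {R R' : Multiset ℕ} {O₁ O₂ : Orbit n},
      O.content = a ::ₘ (b + 1) ::ₘ R → O.content = c ::ₘ (d + 1) ::ₘ R' → b + 1 ≤ a → d + 1 ≤ c →
      Move (a + 1) b O₁ O → Move (c + 1) d O₂ O → c ≤ a →
      ∃ X, ReflTransGen Down X O₁ ∧ ReflTransGen Down X O₂ := by
    intro a b c d R R' O₁ O₂ hO hO' hba hdc m₁ m₂ hca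
    have hR := hO.symm.trans hO'
    have hn := one_le_of_content hO
    rcases hca.eq_or_lt with rfl | hca'
    · rw [Multiset.cons_inj_right] at hR
      rcases Multiset.cons_eq_cons.1 hR with ⟨hbd, rfl⟩ | ⟨hne, S, rfl, rfl⟩
      · obtain rfl : b = d := by omega
        rw [m₁.injective hn m₂]
        exact ⟨_, .refl, .refl⟩
      · obtain ⟨k, K⟩ := exists_hasKey hO
        have K₁ := K.of_raise m₁
        have K₂ := K.swap₂.of_raise m₂
        rcases le_total b d with hbd | hbd
        · exact ⟨O₁, .refl, K₁.swap₁₃.down K₂.rotl hbd⟩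
        · exact ⟨O₂, K₂.swap₁₃.down K₁.rotl hbd, .refl⟩
    by_cases hbd : b = d
    · subst hbd
      rw [Multiset.cons_swap, Multiset.cons_swap c, Multiset.cons_inj_right] at hR
      rcases Multiset.cons_eq_cons.1 hR with ⟨h, rfl⟩ | ⟨hne, S, rfl, rfl⟩
      · omega
      · obtain ⟨k, K⟩ := exists_hasKey hO
        exact ⟨O₁, .refl, (K.of_raise m₁).swap₂.down (K.swap₁₃.of_raise m₂).rotr hca⟩
    rcases Multiset.cons_eq_cons.1 hR with ⟨h, -⟩ | ⟨-, S, hS, hS'⟩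
    · omega
    rcases Multiset.cons_eq_cons.1 hS with ⟨rfl, rfl⟩ | ⟨hbc, S₁, rfl, rfl⟩
    · rcases Multiset.cons_eq_cons.1 hS' with ⟨h, -⟩ | ⟨-, S₂, rfl, rfl⟩
      · omega
      · obtain ⟨k, K⟩ := exists_hasKey hO
        have K₁ := K.of_raise m₁
        have K₂ := K.rotl.of_raise m₂
        obtain ⟨X, KX⟩ := K.exists_raise K₁ K₂.rotr
        exact ⟨X, KX.rotl.down K₁.rotl (by omega), KX.down K₂.rotr (by omega)⟩
    · rcases Multiset.cons_eq_cons.1 hS' with ⟨h, -⟩ | ⟨-, S₂, rfl, hS₂⟩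
      · omega
      · rcases Multiset.cons_eq_cons.1 hS₂ with ⟨h, -⟩ | ⟨-, S₃, rfl, rfl⟩
        · omega
        rcases Nat.lt_or_ge b c with hbc' | hbc'
        · rcases le_total d b with hdb | hdb
          · exact join_up_of_interleaved hO hca hdb hbc' m₁ m₂
          · exact ⟨O₁, .refl, down_of_nested hO hca hdb hdc m₁ m₂⟩
        · rcases hbc'.eq_or_lt with rfl | hbc'
          · exact join_up_of_adjacent hO hba hdc m₁ m₂
          · exact join_up_of_separated hO hba hbc' hdc m₁ m₂
  obtain ⟨a, b, R, hO₁, hab, m₁⟩ := h₁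
  obtain ⟨c, d, R', hO₂, hcd, m₂⟩ := h₂
  obtain ⟨a', ha, hO⟩ := m₁.content hO₁
  obtain rfl : a = a' := by omega
  obtain ⟨c', hc, hO'⟩ := m₂.content hO₂
  obtain rfl : c = c' := by omega
  rcases le_total c a with hca | hca
  · exact main hO hO' hab hcd m₁ m₂ hca
  · obtain ⟨X, h, h'⟩ := main hO' hO hcd hab m₂ m₁ hca
    exact ⟨X, h', h⟩

end Orbit

end SLCrystal

namespace SLCrystal

open Relation

namespace Orbit

variable {n : ℕ} {O O' : Orbit n}

/-! ### Classes of orbits under moves -/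

/-- The sum of the squares of the multiplicities, which decreases under `Down`. -/
def sqSum (O : Orbit n) : ℕ := (O.content.map (· ^ 2)).sum

theorem Down.content (h : Down O O') : ∃ a b R, b + 1 ≤ a ∧ O.content = (a + 1) ::ₘ b ::ₘ R ∧
    O'.content = a ::ₘ (b + 1) ::ₘ R := by
  obtain ⟨a, b, R, hO, hab, m⟩ := h
  obtain ⟨a', ha, hO'⟩ := m.content hO
  obtain rfl : a = a' := by omega
  exact ⟨a, b, R, hab, hO, hO'⟩

theorem Down.sqSum_lt (h : Down O O') : O'.sqSum < O.sqSum := by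
  obtain ⟨a, b, R, hab, hO, hO'⟩ := h.content
  simp only [sqSum, hO, hO', Multiset.map_cons, Multiset.sum_cons]
  nlinarith

theorem Down.sum_eq (h : Down O O') : O'.content.sum = O.content.sum := by
  obtain ⟨a, b, R, hab, hO, hO'⟩ := h.content
  simp only [hO, hO', Multiset.sum_cons]
  omega

theorem sum_eq_of_eqvGen (h : EqvGen Down O O') : O.content.sum = O'.content.sum := by
  induction h with
  | rel _ _ h => exact h.sum_eq.symm
  | refl => rfl
  | symm _ _ _ ih => exact ih.symm
  | trans _ _ _ _ _ ih ih' => exact ih.trans ih'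

theorem sqSum_le (O : Orbit n) : O.sqSum ≤ O.content.sum ^ 2 := by
  rw [sqSum]
  induction O.content using Multiset.induction with
  | empty => simp
  | cons a s ih =>
    simp only [Multiset.map_cons, Multiset.sum_cons]
    nlinarith [Nat.zero_le (a * s.sum)]

theorem wf_lower : WellFounded fun O' O : Orbit n => Down O O' :=
  Subrelation.wf (fun h => h.sqSum_lt) (measure sqSum).wf

theorem wf_raise : WellFounded (Down : Orbit n → Orbit n → Prop) := by
  refine Subrelation.wf (fun {O O'} h => ?_)
    (measure fun O : Orbit n => O.content.sum ^ 2 - O.sqSum).wf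
  have h1 := Down.sqSum_lt h
  have h2 := Down.sum_eq h
  have h3 := sqSum_le O
  change O.content.sum ^ 2 - O.sqSum < O'.content.sum ^ 2 - O'.sqSum
  rw [h2]
  omega

/-- In a class an orbit is determined by its content: equal contents allow the same moves, down to
an orbit without further moves, which is unique in the class; and moves are injective. -/
theorem eq_of_eqvGen (h : EqvGen Down O O') (hc : O.content = O'.content) : O = O' := by
  induction O using wf_lower.induction generalizing O' with
  | _ O ih =>
    by_cases hO : ∃ a b R, O.content = (a + 1) ::ₘ b ::ₘ R ∧ b + 1 ≤ a
    · obtain ⟨a, b, R, hR, hab⟩ := hO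
      obtain ⟨P, hP⟩ := exists_move hR (by omega)
      obtain ⟨P', hP'⟩ := exists_move (hc ▸ hR) (by omega)
      have d : Down O P := ⟨a, b, R, hR, hab, hP⟩
      have d' : Down O' P' := ⟨a, b, R, hc ▸ hR, hab, hP'⟩
      obtain ⟨x, hx, e⟩ := hP.content hR
      obtain ⟨x', hx', e'⟩ := hP'.content (hc ▸ hR)
      obtain rfl : x = x' := by omega
      have := ih P d ((EqvGen.symm _ _ (.rel _ _ d)).trans _ _ _ (h.trans _ _ _ (.rel _ _ d')))
        (e.trans e'.symm)
      subst this
      exact hP.injective (one_le_of_content hR) hP'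
    · obtain ⟨X, h1, h2⟩ := join_of_eqvGen wf_lower (fun _ _ _ => down_confluent) h
      rcases ReflTransGen.cases_head h1 with rfl | ⟨Y, ⟨a, b, R, hR, hab, -⟩, -⟩
      · rcases ReflTransGen.cases_head h2 with rfl | ⟨Y, ⟨a, b, R, hR, hab, -⟩, -⟩
        · rfl
        · exact absurd ⟨a, b, R, hc.trans hR, hab⟩ hO
      · exact absurd ⟨a, b, R, hR, hab⟩ hO

/-- A class has a largest orbit, from which all others are reached by `Down`. -/
theorem exists_top (O : Orbit n) :
    ∃ M, EqvGen Down O M ∧ ∀ O', EqvGen Down O O' → ReflTransGen Down M O' := by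
  have hM : ∃ M, EqvGen Down O M ∧ ∀ X, ¬ Down X M := by
    induction O using wf_raise.induction with
    | _ O ih =>
      by_cases h : ∃ X, Down X O
      · obtain ⟨X, hX⟩ := h
        obtain ⟨M, h1, h2⟩ := ih X hX
        exact ⟨M, (EqvGen.symm _ _ (.rel _ _ hX)).trans _ _ _ h1, h2⟩
      · push Not at h
        exact ⟨O, .refl _, h⟩
  obtain ⟨M, hOM, hmax⟩ := hM
  refine ⟨M, hOM, fun O' h => ?_⟩
  have h' : EqvGen (fun a b : Orbit n => Down b a) M O' := by
    have h2 := (EqvGen.symm _ _ hOM).trans _ _ _ h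
    clear h hOM hmax
    induction h2 with
    | rel _ _ h => exact .symm _ _ (.rel _ _ h)
    | refl => exact .refl _
    | symm _ _ _ ih => exact ih.symm
    | trans _ _ _ _ _ ih ih' => exact ih.trans _ _ _ ih'
  obtain ⟨X, h1, h2⟩ := join_of_eqvGen (r := fun a b : Orbit n => Down b a) wf_raise
    (fun a b c h h' => by
      obtain ⟨X, hX, hX'⟩ := up_confluent h h'
      exact ⟨X, ReflTransGen.swap _ _ hX, ReflTransGen.swap _ _ hX'⟩) h'
  rcases ReflTransGen.cases_head h1 with rfl | ⟨Y, hY, -⟩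
  · exact ReflTransGen.swap _ _ h2
  · exact absurd hY (hmax Y)

theorem cF_cS {j : ℕ} {w v : List ℕ} (h : cF j w = some v) : cF j (cS j v) = some (cS j w) := by
  have hc := cF_count h
  have h1 := count_add_ceps j (cS j v)
  have h2 := count_add_ceps j (cS j w)
  have hs : Str j (cS j v) (cS j w) :=
    ((cS_str j v).1.symm.trans (Str.of_cF h).symm).trans (cS_str j w).1
  have e1 := cS_count_left j v
  have e2 := cS_count_left j w
  rcases hs with hs | hs
  · rcases ReflTransGen.cases_head hs with he | ⟨x, hx, hxs⟩
    · rw [he] at e1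
      omega
    · have := cF_count hx
      rw [hx, Str.eq_of_count (Or.inl hxs) (by omega)]
  · have := reach_count hs
    omega

/-- The orbits at the two ends of an arrow of `f_0` are equivalent. In the lower half of a string
the arrow is reflected to one in the upper half; the middle arrow of a string is a reflection. -/
theorem eqvGen_of_cF (hn : 1 ≤ n) {w v : List ℕ} (h : cF 0 w = some v) :
    EqvGen Down (mk n w) (mk n v) := by
  have main : ∀ {w v : List ℕ}, cF 0 w = some v → w.count 1 + 2 ≤ w.count 0 →
      Down (mk n w) (mk n v) := by
    intro w v h hc
    obtain ⟨n, rfl⟩ := Nat.exists_eq_add_of_le' hn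
    obtain ⟨a, ha⟩ := Nat.exists_eq_add_of_le' (by omega : 1 ≤ w.count 0)
    exact ⟨a, w.count 1, (cnts 2 n w : Multiset ℕ), by rw [← ha]; rfl, by omega, w, v, rfl, rfl, ha,
      rfl, h⟩
  have hc := cF_zero_count h
  rcases Nat.lt_or_ge (w.count 1 + 1) (w.count 0) with h1 | h1
  · exact .rel _ _ (main h h1)
  rcases h1.eq_or_lt with h1 | h1
  · have : v = cS 0 w := (Str.of_cF h).eq_cS (by rw [zero_add]; omega)
    rw [this, mk_cS (by omega)]
    exact .refl _
  · have := main (cF_cS h) (by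
      have e1 : (cS 0 v).count 0 = v.count 1 := cS_count_left 0 v
      have e2 : (cS 0 v).count 1 = v.count 0 := cS_count_right 0 v
      omega)
    rw [mk_cS (by omega), mk_cS (by omega)] at this
    exact .symm _ _ (.rel _ _ this)

theorem eqvGen_of_str (hn : 1 ≤ n) {w v : List ℕ} (h : Str 0 w v) :
    EqvGen Down (mk n w) (mk n v) := by
  have main : ∀ {w v : List ℕ}, ReflTransGen (fun a b => cF 0 a = some b) w v →
      EqvGen Down (mk n w) (mk n v) := by
    intro w v h
    induction h with
    | refl => exact .refl _
    | tail _ h ih => exact ih.trans _ _ _ (eqvGen_of_cF hn h)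
  rcases h with h | h
  · exact main h
  · exact (main h).symm

/-- An orbit has only one element with increasing multiplicities. -/
theorem eq_of_sorted {w v : List ℕ} (hw : ∀ j < n, w.count j ≤ w.count (j + 1))
    (hv : ∀ j < n, v.count j ≤ v.count (j + 1)) (h : mk n w = mk n v) : w = v := by
  have key : ∀ {w : List ℕ} {m k : ℕ}, (∀ j, j + 1 < m + k → w.count j ≤ w.count (j + 1)) →
      (cnts m k w).IsChain (· ≤ ·) := by
    intro w m k
    induction k generalizing m with
    | zero => intro h; simp [cnts]
    | succ k ih =>
      intro h
      have h1 := ih (m := m + 1) fun j hj => h j (by omega)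
      cases k with
      | zero => simp [cnts]
      | succ k => exact List.IsChain.cons_cons (h m (by omega)) h1
  have hp : (cnts 0 (n + 1) w).Perm (cnts 0 (n + 1) v) := Quotient.exact (congrArg content h)
  have := hp.eq_of_pairwise (fun a b _ _ => le_antisymm)
    (List.isChain_iff_pairwise.1 (key fun j hj => hw j (by omega)))
    (List.isChain_iff_pairwise.1 (key fun j hj => hv j (by omega)))
  exact (mk_eq_mk.1 h).eq_of_count fun i hi =>
    count_eq_of_cnts_eq this i (Nat.zero_le i) (by omega)

end Orbit

end SLCrystal

namespace SLCrystal

open Relation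

variable {n : ℕ}

/-! ### From words in the letters of the vector representation to words over the natural numbers -/

/-- The word over `ℕ` obtained by reversing the order of the alphabet. The operators `fᵢ` and `eᵢ`
become `cE` and `cF` with index `i.rev`; in particular `fₙ` acts on the letters `0` and `1`. -/
def cw (w : Word n) : List ℕ := w.map fun a => (a.rev : ℕ)

theorem letter_injective : Function.Injective fun a : Fin (n + 1) => (a.rev : ℕ) :=
  Fin.val_injective.comp Fin.rev_injective

theorem cw_injective : Function.Injective (cw : Word n → List ℕ) :=
  List.map_injective_iff.2 letter_injective

theorem cw_cons (a : Fin (n + 1)) (w : Word n) : cw (a :: w) = (a.rev : ℕ) :: cw w := rfl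

theorem count_cw (a : Fin (n + 1)) (w : Word n) : (cw w).count (a.rev : ℕ) = w.count a :=
  List.count_map_of_injective w _ letter_injective a

theorem count_cw_castSucc (i : Fin n) (w : Word n) :
    (cw w).count ((i.rev : ℕ) + 1) = w.count i.castSucc := by
  rw [← count_cw, Fin.rev_castSucc, Fin.val_succ]

theorem count_cw_succ (i : Fin n) (w : Word n) : (cw w).count (i.rev : ℕ) = w.count i.succ := by
  rw [← count_cw, Fin.rev_succ, Fin.val_castSucc]

theorem rev_eq_succ_iff (i : Fin n) (a : Fin (n + 1)) : (a.rev : ℕ) = i.rev ↔ a = i.succ := by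
  rw [← letter_injective.eq_iff (a := a), Fin.rev_succ, Fin.val_castSucc]

theorem rev_eq_castSucc_iff (i : Fin n) (a : Fin (n + 1)) :
    (a.rev : ℕ) = i.rev + 1 ↔ a = i.castSucc := by
  rw [← letter_injective.eq_iff (a := a), Fin.rev_castSucc, Fin.val_succ]

theorem phi_eq (i : Fin n) (w : Word n) : phi i w = ceps i.rev (cw w) := by
  induction w with
  | nil => rfl
  | cons a w ih => simp only [phi, cw_cons, ceps, ih, rev_eq_succ_iff, rev_eq_castSucc_iff]

theorem eps_eq (i : Fin n) (w : Word n) : eps i w = cphi i.rev (cw w) := by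
  induction w with
  | nil => rfl
  | cons a w ih => simp only [eps, cw_cons, cphi, ih, rev_eq_succ_iff, phi_eq]

theorem map_wordF (i : Fin n) (w : Word n) : (wordF i w).map cw = cE i.rev (cw w) := by
  induction w with
  | nil => rfl
  | cons a w ih =>
    simp only [wordF, cw_cons, cE, rev_eq_succ_iff, rev_eq_castSucc_iff, ← ih, phi_eq]
    by_cases h : (if a = i.succ then 1 else 0) < ceps i.rev (cw w)
    · simp only [h, if_true, Option.map_map]
      rfl
    · simp only [h, if_false]
      split_ifs <;> simp [cw_cons, Fin.rev_succ]

theorem map_wordE (i : Fin n) (w : Word n) : (wordE i w).map cw = cF i.rev (cw w) := by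
  induction w with
  | nil => rfl
  | cons a w ih =>
    simp only [wordE, cw_cons, cF, rev_eq_succ_iff, ← ih, phi_eq]
    by_cases h : ceps i.rev (cw w) < (if a = i.succ then 1 else 0)
    · simp only [h, if_true, Option.map_some, cw_cons, Fin.rev_castSucc, Fin.val_succ]
    · simp only [h, if_false, Option.map_map]
      rfl

theorem cw_wordRefl (i : Fin n) (w : Word n) : cw (wordRefl i w) = cS i.rev (cw w) := by
  have hF : Function.Semiconj cw (fun v => (wordF i v).getD v)
      (fun v => (cE i.rev v).getD v) := fun v => by
    beta_reduce
    rw [← map_wordF]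
    cases wordF i v <;> rfl
  have hE : Function.Semiconj cw (fun v => (wordE i v).getD v)
      (fun v => (cF i.rev v).getD v) := fun v => by
    beta_reduce
    rw [← map_wordE]
    cases wordE i v <;> rfl
  rw [wordRefl, cS, (hE.iterate_right _).eq, (hF.iterate_right _).eq, phi_eq, eps_eq]

theorem wordF_eq_some {i : Fin n} {v w : Word n} :
    wordF i v = some w ↔ cF i.rev (cw w) = some (cw v) := by
  rw [cF_iff_cE, ← map_wordF, Option.map_eq_some_iff]
  exact ⟨fun h => ⟨w, h, rfl⟩, fun ⟨_, h, e⟩ => cw_injective e ▸ h⟩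

theorem exists_of_cF {i : Fin n} {v : Word n} {u : List ℕ} (h : cF i.rev (cw v) = some u) :
    ∃ w, wordE i v = some w ∧ cw w = u := by
  rw [← map_wordE, Option.map_eq_some_iff] at h
  exact h

theorem exists_of_cE {i : Fin n} {v : Word n} {u : List ℕ} (h : cE i.rev (cw v) = some u) :
    ∃ w, wordF i v = some w ∧ cw w = u := by
  rw [← map_wordF, Option.map_eq_some_iff] at h
  exact h

theorem val_rev_lastIdx [NeZero n] : ((lastIdx n).rev : ℕ) = 0 := by
  rw [Fin.val_rev, lastIdx]
  have := NeZero.pos n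
  simp only
  omega

namespace Crystal

variable {lam : Fin n → ℕ}

/-- The word over the reversed alphabet `ℕ` of an element of `B(λ)`. -/
def cword (T : Crystal lam) : List ℕ := cw T.1

theorem cword_injective : Function.Injective (cword : Crystal lam → List ℕ) :=
  cw_injective.comp Subtype.val_injective

theorem cword_refl (i : Fin n) (T : Crystal lam) : (refl i T).cword = cS i.rev T.cword :=
  cw_wordRefl i T.1

theorem f_eq_some {i : Fin n} {T T' : Crystal lam} :
    f i T = some T' ↔ cF i.rev T'.cword = some T.cword := by
  rw [cword, cword, ← wordF_eq_some]
  refine Option.pmap_eq_some_iff.trans ⟨?_, fun h => ⟨T'.1, T'.2, h, rfl⟩⟩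
  rintro ⟨w, h, e, rfl⟩
  exact e

theorem exists_of_str {i : Fin n} {T : Crystal lam} {v : List ℕ} (h : Str i.rev T.cword v) :
    ∃ T' : Crystal lam, T'.cword = v := by
  rcases h with h | h
  · induction h with
    | refl => exact ⟨T, rfl⟩
    | tail _ h ih =>
      obtain ⟨S, rfl⟩ := ih
      obtain ⟨w, hw, rfl⟩ := exists_of_cF h
      exact ⟨⟨w, S.2.tail ⟨i, Or.inr hw⟩⟩, rfl⟩
  · induction h using ReflTransGen.head_induction_on with
    | refl => exact ⟨T, rfl⟩
    | head h _ ih =>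
      obtain ⟨S, rfl⟩ := ih
      rw [cF_iff_cE] at h
      obtain ⟨w, hw, rfl⟩ := exists_of_cE h
      exact ⟨⟨w, S.2.tail ⟨i, Or.inl hw⟩⟩, rfl⟩

theorem act_cons (i : Fin n) (l : List (Fin n)) (T : Crystal lam) :
    act (i :: l) T = refl i (act l T) := rfl

theorem act_append (l l' : List (Fin n)) (T : Crystal lam) : act (l ++ l') T = act l (act l' T) :=
  List.foldr_append

theorem refl_refl (i : Fin n) (T : Crystal lam) : refl i (refl i T) = T :=
  cword_injective (by rw [cword_refl, cword_refl, cS_cS])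

theorem act_act_reverse (l : List (Fin n)) (T : Crystal lam) : act l (act l.reverse T) = T := by
  induction l generalizing T with
  | nil => rfl
  | cons i l ih =>
    rw [List.reverse_cons, act_append, act_cons, ih]
    exact refl_refl i T

/-! ### Orbits in the crystal -/

/-- The Weyl group orbit of an element of `B(λ)`. -/
def orbit (T : Crystal lam) : Orbit n := Orbit.mk n T.cword

theorem orbit_refl (i : Fin n) (T : Crystal lam) : (refl i T).orbit = T.orbit := by
  rw [orbit, cword_refl]
  exact Orbit.mk_cS i.rev.isLt _

theorem orbit_act (l : List (Fin n)) (T : Crystal lam) : (act l T).orbit = T.orbit := by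
  induction l with
  | nil => rfl
  | cons i l ih => rw [act_cons, orbit_refl, ih]

theorem exists_of_orb {T : Crystal lam} {v : List ℕ} (h : Orb 0 (n + 1) T.cword v) :
    ∃ l, (act l T).cword = v := by
  induction h with
  | refl => exact ⟨[], rfl⟩
  | tail _ h ih =>
    obtain ⟨l, rfl⟩ := ih
    obtain ⟨j, -, hj, rfl⟩ := h
    refine ⟨(⟨j, by omega⟩ : Fin n).rev :: l, ?_⟩
    rw [act_cons, cword_refl, Fin.rev_rev]

theorem exists_of_mk_eq {T : Crystal lam} {v : List ℕ} (h : Orbit.mk n v = T.orbit) :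
    ∃ l, (act l T).cword = v :=
  exists_of_orb (Orbit.mk_eq_mk.1 h.symm)

theorem sameOrbit_iff {T T' : Crystal lam} : SameOrbit T T' ↔ T.orbit = T'.orbit := by
  constructor
  · rintro ⟨l, rfl⟩
    exact orbit_act l T'
  · intro h
    obtain ⟨l, hl⟩ := exists_of_mk_eq h
    exact ⟨l, (cword_injective hl).symm⟩

theorem isDominant_iff {T : Crystal lam} :
    IsDominant T.wt ↔ ∀ j < n, T.cword.count j ≤ T.cword.count (j + 1) := by
  constructor
  · intro h j hj
    have := h (⟨j, hj⟩ : Fin n).rev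
    rw [wt, wordWt, ← count_cw_castSucc, ← count_cw_succ, Fin.rev_rev] at this
    exact_mod_cast (sub_nonneg.1 this)
  · intro h i
    rw [wt, wordWt, ← count_cw_castSucc, ← count_cw_succ]
    exact sub_nonneg.2 (by exact_mod_cast h _ i.rev.isLt)

theorem eq_of_isDominant {T T' : Crystal lam} (h : IsDominant T.wt) (h' : IsDominant T'.wt)
    (ho : T.orbit = T'.orbit) : T = T' :=
  cword_injective (Orbit.eq_of_sorted (isDominant_iff.1 h) (isDominant_iff.1 h') ho)

theorem exists_isDominant (T : Crystal lam) : ∃ D : Crystal lam, IsDominant D.wt ∧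
    D.orbit = T.orbit := by
  obtain ⟨v, hv, hs⟩ := exists_sorted (n + 1) T.cword
  obtain ⟨l, hl⟩ := exists_of_orb (Orb.of_sort hv)
  refine ⟨act l T, isDominant_iff.2 fun j hj => ?_, orbit_act l T⟩
  rw [hl]
  exact hs j (by omega)

end Crystal

open Crystal

section Components

variable [NeZero n] {lam : Fin n → ℕ}

/-! ### Components of the graph of the last crystal operator -/

theorem graphOne_reachable_of_orbit_eq {T T' : Crystal lam} (h : T.orbit = T'.orbit) :
    (graphOne lam).Reachable T T' := by
  by_cases e : T = T'
  · exact e ▸ .refl _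
  · exact SimpleGraph.Adj.reachable ⟨e, Or.inl (Or.inl (sameOrbit_iff.2 h))⟩

theorem graphOne_reachable_of_f {T T' : Crystal lam} (h : f (lastIdx n) T' = some T) :
    (graphOne lam).Reachable T T' := by
  by_cases e : T = T'
  · exact e ▸ .refl _
  · exact SimpleGraph.Adj.reachable ⟨e, Or.inl (Or.inr h)⟩

theorem f_lastIdx_eq_some {T T' : Crystal lam} :
    f (lastIdx n) T = some T' ↔ cF 0 T'.cword = some T.cword := by
  rw [f_eq_some, val_rev_lastIdx]

theorem eqvGen_of_f {T T' : Crystal lam} (h : f (lastIdx n) T' = some T) :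
    EqvGen Orbit.Down T.orbit T'.orbit :=
  Orbit.eqvGen_of_cF (NeZero.one_le) (f_lastIdx_eq_some.1 h)

theorem eqvGen_of_reachable {T T' : Crystal lam} (h : (graphOne lam).Reachable T T') :
    EqvGen Orbit.Down T.orbit T'.orbit := by
  obtain ⟨p⟩ := h
  induction p with
  | nil => exact .refl _
  | cons h _ ih =>
    refine EqvGen.trans _ _ _ ?_ ih
    rcases h.2 with (h | h) | (h | h)
    · rw [sameOrbit_iff.1 h]
      exact .refl _
    · exact eqvGen_of_f h
    · rw [sameOrbit_iff.1 h]
      exact .refl _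
    · exact (eqvGen_of_f h).symm

/-- Equivalences of orbits lift to `B(λ)`: since `B(λ)` is closed under crystal operators, it meets
every orbit of the class. For symmetry, both ends may be prescribed. -/
theorem exists_lift_eqvGen {O O' : Orbit n} (h : EqvGen Orbit.Down O O') :
    (∀ T : Crystal lam, T.orbit = O → ∃ T' : Crystal lam, T'.orbit = O' ∧
      (graphOne lam).Reachable T T') ∧
    ∀ T : Crystal lam, T.orbit = O' → ∃ T' : Crystal lam, T'.orbit = O ∧
      (graphOne lam).Reachable T T' := by
  induction h with
  | rel O O' h =>
    obtain ⟨a, b, R, -, -, v, u, hv, hu, -, -, hvu⟩ := h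
    have hstr : Str (lastIdx n).rev v u := by
      rw [val_rev_lastIdx]
      exact Str.of_cF hvu
    constructor
    · intro T hT
      obtain ⟨l, hl⟩ := exists_of_mk_eq (hv.trans hT.symm)
      obtain ⟨S, rfl⟩ := exists_of_str (T := act l T) (by rw [hl]; exact hstr)
      rw [← hl] at hvu
      exact ⟨S, hu, (graphOne_reachable_of_orbit_eq (orbit_act l T).symm).trans
        (graphOne_reachable_of_f (f_lastIdx_eq_some.2 hvu))⟩
    · intro T hT
      obtain ⟨l, hl⟩ := exists_of_mk_eq (hu.trans hT.symm)
      obtain ⟨S, rfl⟩ := exists_of_str (T := act l T) (by rw [hl]; exact hstr.symm)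
      rw [← hl] at hvu
      exact ⟨S, hv, (graphOne_reachable_of_orbit_eq (orbit_act l T).symm).trans
        (graphOne_reachable_of_f (f_lastIdx_eq_some.2 hvu)).symm⟩
  | refl O => exact ⟨fun T hT => ⟨T, hT, .refl _⟩, fun T hT => ⟨T, hT, .refl _⟩⟩
  | symm _ _ _ ih => exact ih.symm
  | trans _ _ _ _ _ ih ih' =>
    constructor
    · intro T hT
      obtain ⟨S, hS, h⟩ := ih.1 T hT
      obtain ⟨S', hS', h'⟩ := ih'.1 S hS
      exact ⟨S', hS', h.trans h'⟩
    · intro T hT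
      obtain ⟨S, hS, h⟩ := ih'.2 T hT
      obtain ⟨S', hS', h'⟩ := ih.2 S hS
      exact ⟨S', hS', h.trans h'⟩

/-- The components of `𝔹₁(λ)` are the classes of orbits under moves. -/
theorem reachable_iff {T T' : Crystal lam} :
    (graphOne lam).Reachable T T' ↔ EqvGen Orbit.Down T.orbit T'.orbit := by
  refine ⟨eqvGen_of_reachable, fun h => ?_⟩
  obtain ⟨S, hS, h⟩ := (exists_lift_eqvGen h).1 T rfl
  exact h.trans (graphOne_reachable_of_orbit_eq hS)

end Components

end SLCrystal

namespace SLCrystal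

open Relation

variable {n : ℕ}

/-! ### Weights and permutations -/

/-- The weight of `SL_{n+1}` given by coordinates in `ℤ^{n+1}`, which are unique up to adding a
constant vector. -/
def wtOf : (Fin (n + 1) → ℤ) →ₗ[ℤ] Weight n where
  toFun g i := g i.castSucc - g i.succ
  map_add' g h := by ext i; simp only [Pi.add_apply]; ring
  map_smul' r g := by ext i; simp only [Pi.smul_apply, RingHom.id_apply, smul_eq_mul]; ring

theorem wtOf_apply (g : Fin (n + 1) → ℤ) (i : Fin n) : wtOf g i = g i.castSucc - g i.succ := rfl

/-- The root `ε_a - ε_b`. -/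
def root (a b : Fin (n + 1)) : Fin (n + 1) → ℤ := Pi.single a 1 - Pi.single b 1

theorem root_apply (a b x : Fin (n + 1)) :
    root a b x = (if x = a then 1 else 0) - (if x = b then 1 else 0) := by
  simp only [root, Pi.sub_apply, Pi.single_apply]

theorem root_comp (σ : Equiv.Perm (Fin (n + 1))) (a b : Fin (n + 1)) :
    root a b ∘ (σ⁻¹ : Equiv.Perm (Fin (n + 1))) = root (σ a) (σ b) := by
  ext x
  simp only [Function.comp_apply, root_apply, Equiv.Perm.inv_eq_iff_eq]

theorem simpleRoot_eq (i : Fin n) : simpleRoot i = wtOf (root i.castSucc i.succ) := by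
  ext j
  simp only [simpleRoot, CartanMatrix.A, Matrix.of_apply, wtOf_apply, root_apply, Fin.ext_iff,
    Fin.val_castSucc, Fin.val_succ]
  split_ifs <;> first | rfl | omega

theorem sum_Icc_telescope {M : Type*} [AddCommGroup M] (h : Fin (n + 1) → M) {j k : Fin n}
    (hjk : j ≤ k) :
    ∑ i ∈ Finset.Icc j k, (h i.castSucc - h i.succ) = h j.castSucc - h k.succ := by
  rw [← neg_inj, ← Finset.sum_neg_distrib]
  simp only [neg_sub]
  exact Fin.sum_Icc_sub hjk h

theorem posRoot_eq {j k : Fin n} (hjk : j ≤ k) :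
    posRoot j k = wtOf (root j.castSucc k.succ) := by
  simp only [posRoot, simpleRoot_eq, root]
  rw [← map_sum, sum_Icc_telescope (fun a => Pi.single a (1 : ℤ)) hjk]

theorem pairing_eq (g : Fin (n + 1) → ℤ) {j k : Fin n} (hjk : j ≤ k) :
    pairing (wtOf g) j k = g j.castSucc - g k.succ :=
  sum_Icc_telescope g hjk

/-- The permutation of the letters given by a word in the simple reflections, under `W ≅ S_{n+1}`.
-/
def permOf (l : List (Fin n)) : Equiv.Perm (Fin (n + 1)) :=
  (l.map fun i => Equiv.swap i.castSucc i.succ).prod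

theorem permOf_cons (i : Fin n) (l : List (Fin n)) :
    permOf (i :: l) = Equiv.swap i.castSucc i.succ * permOf l := by
  simp [permOf]

theorem exists_permOf (σ : Equiv.Perm (Fin (n + 1))) : ∃ l : List (Fin n), permOf l = σ := by
  have h : σ ∈ Submonoid.closure
      (Set.range fun i : Fin n => Equiv.swap i.castSucc i.succ) := by
    rw [Equiv.Perm.mclosure_swap_castSucc_succ]
    trivial
  induction h using Submonoid.closure_induction with
  | mem _ h =>
    obtain ⟨i, rfl⟩ := h
    exact ⟨[i], by simp [permOf]⟩
  | one => exact ⟨[], rfl⟩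
  | mul _ _ _ _ h h' =>
    obtain ⟨l, rfl⟩ := h
    obtain ⟨l', rfl⟩ := h'
    exact ⟨l ++ l', by simp [permOf]⟩

theorem exists_permOf_pair {a b p q : Fin (n + 1)} (hab : a ≠ b) (hpq : p ≠ q) :
    ∃ l : List (Fin n), permOf l a = p ∧ permOf l b = q := by
  obtain ⟨l, hl⟩ := exists_permOf
    (Equiv.swap (Equiv.swap a p b) q * Equiv.swap a p)
  refine ⟨l, ?_, ?_⟩
  · rw [hl, Equiv.Perm.mul_apply, Equiv.swap_apply_left]
    refine Equiv.swap_apply_of_ne_of_ne (fun h => hab ?_) hpq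
    rw [← Equiv.swap_apply_left a p] at h
    exact (Equiv.swap a p).injective (by rwa [Equiv.swap_apply_left] at h ⊢)
  · rw [hl, Equiv.Perm.mul_apply, Equiv.swap_apply_left]

theorem reflWeight_wtOf (i : Fin n) (g : Fin (n + 1) → ℤ) :
    reflWeight i (wtOf g) = wtOf (g ∘ Equiv.swap i.castSucc i.succ) := by
  rw [reflWeight, simpleRoot_eq, wtOf_apply, ← map_smul, ← map_sub]
  congr 1
  ext x
  simp only [Pi.sub_apply, Pi.smul_apply, root_apply, Function.comp_apply, smul_eq_mul,
    Equiv.swap_apply_def]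
  have := (Fin.castSucc_lt_succ (i := i)).ne
  split_ifs <;> simp_all

theorem actWeight_wtOf (l : List (Fin n)) (g : Fin (n + 1) → ℤ) :
    actWeight l (wtOf g) = wtOf (g ∘ ((permOf l)⁻¹ : Equiv.Perm (Fin (n + 1)))) := by
  induction l with
  | nil => rfl
  | cons i l ih =>
    change reflWeight i (actWeight l (wtOf g)) = _
    rw [ih, reflWeight_wtOf, permOf_cons, mul_inv_rev, Equiv.swap_inv]
    rfl

namespace Crystal

variable {lam : Fin n → ℕ}

/-- The weight of `T` as an element of `ℤ^{n+1}`: the multiplicities of the letters. -/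
def cnt (T : Crystal lam) : Fin (n + 1) → ℤ := fun a => (T.1.count a : ℤ)

theorem cnt_eq (T : Crystal lam) (a : Fin (n + 1)) :
    T.cnt a = (T.cword.count (a.rev : ℕ) : ℤ) := by
  rw [cword, count_cw]
  rfl

theorem wt_eq (T : Crystal lam) : T.wt = wtOf T.cnt := rfl

theorem cnt_castSucc (T : Crystal lam) (i : Fin n) :
    T.cnt i.castSucc = (T.cword.count ((i.rev : ℕ) + 1) : ℤ) := by
  rw [cnt_eq, Fin.rev_castSucc, Fin.val_succ]

theorem cnt_succ (T : Crystal lam) (i : Fin n) :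
    T.cnt i.succ = (T.cword.count (i.rev : ℕ) : ℤ) := by
  rw [cnt_eq, Fin.rev_succ, Fin.val_castSucc]

/-- Along an `αᵢ`-string, the weight changes by a multiple of `αᵢ`. -/
theorem cnt_of_str {i : Fin n} {T S : Crystal lam} (h : Str i.rev T.cword S.cword) :
    S.cnt = T.cnt - (T.cnt i.castSucc - S.cnt i.castSucc) • root i.castSucc i.succ := by
  have h1 := h.count_add
  rw [Pi.sub_def]
  ext x
  have hne := (Fin.castSucc_lt_succ (i := i)).ne
  simp only [Pi.smul_apply, root_apply, smul_eq_mul]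
  by_cases h2 : x = i.castSucc
  · subst h2
    rw [if_pos rfl, if_neg hne]
    ring
  by_cases h3 : x = i.succ
  · subst h3
    rw [if_neg hne.symm, if_pos rfl]
    simp only [cnt_castSucc, cnt_succ]
    omega
  · rw [if_neg h2, if_neg h3, cnt_eq, cnt_eq,
      h.count_of_ne (fun e => h3 ((rev_eq_succ_iff i x).1 e))
        (fun e => h2 ((rev_eq_castSucc_iff i x).1 e))]
    ring

theorem cnt_refl (i : Fin n) (T : Crystal lam) :
    (refl i T).cnt = T.cnt ∘ Equiv.swap i.castSucc i.succ := by
  ext x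
  rw [Function.comp_apply, Equiv.swap_apply_def]
  split_ifs with h1 h2
  · rw [h1, cnt_castSucc, cnt_succ, cword_refl, cS_count_right]
  · rw [h2, cnt_castSucc, cnt_succ, cword_refl, cS_count_left]
  · rw [cnt_eq, cnt_eq, cword_refl, cS_count_of_ne _ (fun e => h2 ((rev_eq_succ_iff i x).1 e))
      (fun e => h1 ((rev_eq_castSucc_iff i x).1 e))]

theorem cnt_act (l : List (Fin n)) (T : Crystal lam) :
    (act l T).cnt = T.cnt ∘ ((permOf l)⁻¹ : Equiv.Perm (Fin (n + 1))) := by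
  induction l with
  | nil => rfl
  | cons i l ih =>
    rw [act_cons, cnt_refl, ih, permOf_cons, mul_inv_rev, Equiv.swap_inv]
    rfl

theorem cnt_act_reverse (l : List (Fin n)) (T : Crystal lam) (a : Fin (n + 1)) :
    (act l.reverse T).cnt a = T.cnt (permOf l a) := by
  conv_rhs => rw [← act_act_reverse l T, cnt_act, Function.comp_apply, Equiv.Perm.inv_def,
    Equiv.symm_apply_apply]

end Crystal

end SLCrystal

namespace SLCrystal

open Relation

variable {n : ℕ}

namespace Crystal

variable {lam : Fin n → ℕ}

/-! ### Dominant elements and the Bruhat order -/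

theorem mem_content {T : Crystal lam} {a : ℕ} (h : a ∈ T.orbit.content) :
    ∃ x : Fin (n + 1), T.cnt x = a := by
  have key : ∀ (k m : ℕ), a ∈ cnts m k T.cword → ∃ i < m + k, T.cword.count i = a := by
    intro k
    induction k with
    | zero => intro m h; simp [cnts] at h
    | succ k ih =>
      intro m h
      rcases List.mem_cons.1 h with rfl | h
      · exact ⟨m, by omega, rfl⟩
      · obtain ⟨i, hi, e⟩ := ih _ h
        exact ⟨i, by omega, e⟩
  obtain ⟨i, hi, e⟩ := key (n + 1) 0 h
  refine ⟨(⟨i, by omega⟩ : Fin (n + 1)).rev, ?_⟩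
  rw [cnt_eq, Fin.rev_rev, e]

theorem antitone_cnt {T : Crystal lam} (h : IsDominant T.wt) : Antitone T.cnt :=
  Fin.antitone_iff_succ_le.2 fun i => sub_nonneg.1 (h i)

/-- Elements of one class with the same weight are equal: the weight determines the multiplicities
up to a constant, and their sum is constant on the class. -/
theorem eq_of_wt_eq {T T' : Crystal lam} (h : EqvGen Orbit.Down T.orbit T'.orbit)
    (hw : T.wt = T'.wt) : T = T' := by
  have hj : ∀ j < n, T.cword.count (j + 1) + T'.cword.count j =
      T'.cword.count (j + 1) + T.cword.count j := by
    intro j hj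
    have := congrFun hw (⟨j, hj⟩ : Fin n).rev
    rw [wt_eq, wt_eq, wtOf_apply, wtOf_apply, cnt_castSucc, cnt_castSucc, cnt_succ, cnt_succ,
      Fin.rev_rev] at this
    simp only at this
    omega
  have hi : ∀ i ≤ n, T.cword.count i + T'.cword.count 0 = T'.cword.count i + T.cword.count 0 := by
    intro i
    induction i with
    | zero => intro _; exact add_comm _ _
    | succ i ih =>
      intro hi
      have h1 := ih (by omega)
      have h2 := hj i (by omega)
      omega
  have hs : ∀ k m, m + k ≤ n + 1 → (cnts m k T.cword).sum + k * T'.cword.count 0 =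
      (cnts m k T'.cword).sum + k * T.cword.count 0 := by
    intro k
    induction k with
    | zero => intro m _; simp [cnts]
    | succ k ih =>
      intro m hm
      have h1 := ih (m + 1) (by omega)
      have h2 := hi m (by omega)
      simp only [cnts_succ, List.sum_cons]
      linarith
  have h0 : T.cword.count 0 = T'.cword.count 0 := by
    have h1 := hs (n + 1) 0 (by omega)
    have h2 : (cnts 0 (n + 1) T.cword).sum = (cnts 0 (n + 1) T'.cword).sum :=
      Orbit.sum_eq_of_eqvGen h
    rw [h2] at h1
    exact (Nat.eq_of_mul_eq_mul_left n.succ_pos (Nat.add_left_cancel h1)).symm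
  have hc : ∀ i < n + 1, T.cword.count i = T'.cword.count i := by
    intro i h
    have := hi i (by omega)
    omega
  have ho := Orbit.eq_of_eqvGen h (congrArg (fun l : List ℕ => (l : Multiset ℕ))
    (cnts_congr (m := 0) fun i _ h => hc i (by omega)))
  exact cword_injective ((Orbit.mk_eq_mk.1 ho).eq_of_count hc)

/-- Every element lies below the dominant element of its orbit: each step of sorting the
multiplicities is a reflection in a hyperplane through the origin. -/
theorem exists_isDominant_le (T : Crystal lam) : ∃ D : Crystal lam, IsDominant D.wt ∧
    D.orbit = T.orbit ∧ BruhatLE T.wt D.wt := by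
  obtain ⟨v, hv, hs⟩ := exists_sorted (n + 1) T.cword
  suffices ∃ D : Crystal lam, D.cword = v ∧ BruhatLE T.wt D.wt by
    obtain ⟨D, rfl, hD⟩ := this
    exact ⟨D, isDominant_iff.2 fun j hj => hs j (by omega),
      (Orbit.mk_eq_mk.2 (Orb.of_sort hv)).symm, hD⟩
  clear hs
  induction hv with
  | refl => exact ⟨T, rfl, .refl⟩
  | tail _ h ih =>
    obtain ⟨D, rfl, hD⟩ := ih
    obtain ⟨j, hj, hlt, rfl⟩ := h
    have hj' : j < n := by omega
    let i : Fin n := (⟨j, hj'⟩ : Fin n).rev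
    have hi : (i.rev : ℕ) = j := by simp [i]
    refine ⟨refl i D, by rw [cword_refl, hi], hD.tail ⟨i, i, le_rfl, 0, ?_, Or.inl ⟨le_rfl, ?_⟩⟩⟩
    · have : D = refl i (refl i D) := (refl_refl i D).symm
      conv_lhs => rw [this, wt_eq, cnt_refl, ← reflWeight_wtOf]
      rw [reflWeight, wt_eq, pairing_eq _ le_rfl, wtOf_apply, sub_zero, posRoot, Finset.Icc_self,
        Finset.sum_singleton]
    · rw [wt_eq, pairing_eq _ le_rfl, cnt_castSucc, cnt_succ, cword_refl, hi, cS_count_left,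
        cS_count_right]
      omega

end Crystal

open Crystal

section Components

variable [NeZero n] {lam : Fin n → ℕ}

/-- A `Down` relation between the orbits of two dominant elements is realised by a modified crystal
operator `f̃_α`. Of the letters which occur `a + 1` times the last is taken, and of those which
occur `b` times the first, so that the result is again dominant. -/
theorem exists_modF_of_down {D D' : Crystal lam} (hD : IsDominant D.wt) (hD' : IsDominant D'.wt)
    (h : Orbit.Down D.orbit D'.orbit) :
    ∃ j k : Fin n, j ≤ k ∧ ModF lam (posRoot j k) D D' ∧ D'.wt = D.wt - posRoot j k ∧
      2 ≤ pairing D.wt j k := by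
  obtain ⟨a, b, R, hc, hab, hm⟩ := h
  have hanti := antitone_cnt hD
  -- The letters are taken in the original alphabet, in which the multiplicities decrease.
  obtain ⟨p, hp, hp'⟩ : ∃ p, D.cnt p = ((a + 1 : ℕ) : ℤ) ∧
      ∀ x, D.cnt x = ((a + 1 : ℕ) : ℤ) → x ≤ p := by
    obtain ⟨x, hx⟩ := mem_content (T := D) (a := a + 1) (by rw [hc]; simp)
    have hne : (Finset.univ.filter fun x => D.cnt x = ((a + 1 : ℕ) : ℤ)).Nonempty :=
      ⟨x, by simpa using hx⟩
    refine ⟨_, (Finset.mem_filter.1 (Finset.max'_mem _ hne)).2, fun y hy => ?_⟩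
    exact Finset.le_max' _ y (Finset.mem_filter.2 ⟨Finset.mem_univ y, hy⟩)
  obtain ⟨q, hq, hq'⟩ : ∃ q, D.cnt q = (b : ℤ) ∧ ∀ x, D.cnt x = (b : ℤ) → q ≤ x := by
    obtain ⟨x, hx⟩ := mem_content (T := D) (a := b) (by rw [hc]; simp)
    have hne : (Finset.univ.filter fun x => D.cnt x = (b : ℤ)).Nonempty :=
      ⟨x, by simpa using hx⟩
    refine ⟨_, (Finset.mem_filter.1 (Finset.min'_mem _ hne)).2, fun y hy => ?_⟩
    exact Finset.min'_le _ y (Finset.mem_filter.2 ⟨Finset.mem_univ y, hy⟩)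
  have hpq : p < q := by
    by_contra hle
    have := hanti (not_lt.1 hle)
    omega
  obtain ⟨j, rfl⟩ := Fin.exists_castSucc_eq.2 (hpq.trans_le (Fin.le_last q)).ne
  obtain ⟨k, rfl⟩ := Fin.exists_succ_eq.2 ((Fin.zero_le _).trans_lt hpq).ne'
  have hjk : j ≤ k := Fin.castSucc_lt_succ_iff.1 hpq
  let t := lastIdx n
  obtain ⟨l, hl1, hl2⟩ := exists_permOf_pair (a := t.castSucc) (b := t.succ)
    Fin.castSucc_lt_succ.ne hpq.ne
  have hV1 := cnt_act_reverse l D t.castSucc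
  have hV0 := cnt_act_reverse l D t.succ
  rw [hl1, hp, cnt_castSucc, val_rev_lastIdx] at hV1
  rw [hl2, hq, cnt_succ, val_rev_lastIdx] at hV0
  have hV1 : (act l.reverse D).cword.count 1 = a + 1 := Nat.cast_injective hV1
  have hV0 : (act l.reverse D).cword.count 0 = b := Nat.cast_injective hV0
  obtain ⟨u, hu⟩ := cE_isSome (j := 0) (w := (act l.reverse D).cword) (by
    have := count_add_ceps 0 (act l.reverse D).cword
    rw [zero_add] at this
    omega)
  rw [← cF_iff_cE] at hu
  obtain ⟨S, rfl⟩ := exists_of_str (i := t) (T := act l.reverse D) (v := u)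
    (by rw [val_rev_lastIdx]; exact (Str.of_cF hu).symm)
  -- In the reversed alphabet the arrow leads from `S` to `V = act l.reverse D`, in the lower half
  -- of its string. Reflecting the string turns it into a move from the orbit of `V` to that of `S`.
  have hmove : Orbit.Move (a + 1) b D.orbit (act l S).orbit := by
    refine ⟨cS 0 (act l.reverse D).cword, cS 0 S.cword, ?_, ?_, ?_, ?_, Orbit.cF_cS hu⟩
    · rw [Orbit.mk_cS (NeZero.pos n)]
      exact orbit_act _ D
    · rw [Orbit.mk_cS (NeZero.pos n)]
      exact (orbit_act _ S).symm
    · rw [cS_count_left, zero_add, hV1]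
    · exact (cS_count_right 0 _).trans hV0
  have hcnt : (act l S).cnt = D.cnt - root j.castSucc k.succ := by
    have h1 := cnt_of_str (i := t) (T := act l.reverse D) (S := S)
      (by rw [val_rev_lastIdx]; exact (Str.of_cF hu).symm)
    have h2 := (cF_count hu).2.1
    rw [cnt_castSucc, cnt_castSucc, val_rev_lastIdx, h2] at h1
    rw [cnt_act, h1, Nat.cast_add, add_sub_cancel_left, Nat.cast_one, one_smul, sub_eq_add_neg,
      Pi.add_comp, Pi.neg_comp, root_comp, hl1, hl2, ← cnt_act, act_act_reverse, sub_eq_add_neg]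
  have hwt : (act l S).wt = D.wt - posRoot j k := by
    rw [wt_eq, hcnt, map_sub, ← wt_eq, posRoot_eq hjk]
  have hdom : IsDominant (act l S).wt := by
    intro i
    rw [wt_eq, hcnt, wtOf_apply, Pi.sub_apply, Pi.sub_apply, root_apply, root_apply]
    have h1 : D.cnt i.succ ≤ D.cnt i.castSucc := hanti (Fin.castSucc_lt_succ).le
    have hlt := Fin.castSucc_lt_succ (i := i)
    have h2 : i.castSucc = j.castSucc → D.cnt i.succ < a + 1 := fun e => by
      refine lt_of_le_of_ne (by rw [e, hp] at h1; exact_mod_cast h1) fun h => ?_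
      exact absurd (hp' i.succ (by exact_mod_cast h)) (not_le.2 (e ▸ hlt))
    have h3 : i.succ = k.succ → (b : ℤ) < D.cnt i.castSucc := fun e => by
      refine lt_of_le_of_ne (by rw [e, hq] at h1; exact h1) fun h => ?_
      exact absurd (hq' i.castSucc h.symm) (not_le.2 (e ▸ hlt))
    have h4 : i.castSucc = j.castSucc → D.cnt i.castSucc = a + 1 := fun e => by
      rw [e, hp]; push_cast; rfl
    have h5 : i.succ = k.succ → D.cnt i.succ = b := fun e => by rw [e, hq]
    split_ifs <;> simp_all <;> omega
  have hS : act l S = D' := eq_of_isDominant hdom hD'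
    (Orbit.Move.functional (NeZero.one_le) hmove hm)
  refine ⟨j, k, hjk, ⟨l, ?_, ?_⟩, by rw [← hS, hwt], ?_⟩
  · rw [simpleRoot_eq, actWeight_wtOf, root_comp, posRoot_eq hjk]
    exact congrArg wtOf (congrArg₂ root hl1 hl2)
  · rw [f_lastIdx_eq_some.2 hu, Option.map_some, hS]
  · rw [wt_eq, pairing_eq _ hjk, hp, hq]
    push_cast
    omega

theorem eqvGen_of_modF {α : Weight n} {T T' : Crystal lam} (h : ModF lam α T' T) :
    EqvGen Orbit.Down T.orbit T'.orbit := by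
  obtain ⟨l, -, h⟩ := h
  obtain ⟨S, hS, rfl⟩ := Option.map_eq_some_iff.1 h
  have := eqvGen_of_f hS
  rwa [orbit_act, ← orbit_act l S] at this

/-- The LL atoms are the classes of orbits under moves. -/
theorem llEquiv_iff {T T' : Crystal lam} :
    LLEquiv lam T T' ↔ EqvGen Orbit.Down T.orbit T'.orbit := by
  constructor
  · rintro ⟨D, D', hT, hT', ⟨p⟩⟩
    rw [← sameOrbit_iff.1 hT, ← sameOrbit_iff.1 hT']
    clear hT hT'
    induction p with
    | nil => exact .refl _
    | cons h _ ih =>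
      refine EqvGen.trans _ _ _ ?_ ih
      rcases h.2 with ⟨α, -, h⟩ | ⟨α, -, h⟩
      · exact eqvGen_of_modF h
      · exact (eqvGen_of_modF h).symm
  · intro h
    have key : ∀ O O', EqvGen Orbit.Down O O' → EqvGen Orbit.Down O T.orbit →
        ∀ D D' : DominantPart lam, D.1.orbit = O → D'.1.orbit = O' →
          (graphPlus lam).Reachable D D' := by
      intro O O' h
      induction h with
      | rel O O' h =>
        rintro - D D' rfl rfl
        obtain ⟨j, k, hjk, hm, -, -⟩ := exists_modF_of_down D.2 D'.2 h
        by_cases e : D = D'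
        · exact e ▸ .refl _
        · exact SimpleGraph.Adj.reachable ⟨e, Or.inr ⟨_, ⟨j, k, hjk, rfl⟩, hm⟩⟩
      | refl O =>
        rintro - D D' rfl hD'
        rw [Subtype.ext (eq_of_isDominant D'.2 D.2 hD')]
      | symm _ _ h ih =>
        intro hT D D' hD hD'
        exact (ih (h.trans _ _ _ hT) D' D hD' hD).symm
      | trans O P Q h h' ih ih' =>
        intro hT D D' hD hD'
        have hP : EqvGen Orbit.Down P T.orbit := h.symm.trans _ _ _ hT
        obtain ⟨S, hS, -⟩ := (exists_lift_eqvGen hP).2 T rfl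
        obtain ⟨E, hE, hES⟩ := exists_isDominant S
        exact (ih hT D ⟨E, hE⟩ hD (hES.trans hS)).trans
          (ih' hP ⟨E, hE⟩ D' (hES.trans hS) hD')
    obtain ⟨D, hD, hDT⟩ := exists_isDominant T
    obtain ⟨D', hD', hDT'⟩ := exists_isDominant T'
    exact ⟨⟨D, hD⟩, ⟨D', hD'⟩, sameOrbit_iff.2 hDT, sameOrbit_iff.2 hDT',
      key _ _ h (.refl _) _ _ hDT hDT'⟩

/-- A `Down` relation lowers the weight of the dominant element in the Bruhat order. -/
theorem exists_bruhatLE_of_reflTransGen {D : Crystal lam} (hD : IsDominant D.wt) {P : Orbit n}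
    (h : ReflTransGen Orbit.Down D.orbit P) :
    ∃ E : Crystal lam, IsDominant E.wt ∧ E.orbit = P ∧ BruhatLE E.wt D.wt := by
  induction h with
  | refl => exact ⟨D, hD, rfl, .refl⟩
  | tail _ h ih =>
    obtain ⟨E, hE, rfl, hle⟩ := ih
    obtain ⟨S, rfl, -⟩ := (exists_lift_eqvGen (EqvGen.rel _ _ h)).1 E rfl
    obtain ⟨E', hE', ho⟩ := exists_isDominant S
    rw [← ho] at h
    obtain ⟨j, k, hjk, -, hwt, hp⟩ := exists_modF_of_down hE hE' h
    -- Subtracting the root once is the reflection in the hyperplane at height `⟨wt E, α^∨⟩ - 1`.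
    refine ⟨E', hE', ho, .head ⟨j, k, hjk, pairing E.wt j k - 1, ?_, Or.inl ?_⟩ hle⟩
    · rw [hwt, sub_sub_cancel, one_smul]
    · omega

/-- An affine reflection towards the base alcove moves the weight of `T` inside the string of a
conjugate of `fₙ`, which stays in the component of `T`. -/
theorem exists_of_bruhatStep {T : Crystal lam} {ν : Weight n} (h : BruhatStep ν T.wt) :
    ∃ S : Crystal lam, S.wt = ν ∧ EqvGen Orbit.Down T.orbit S.orbit := by
  obtain ⟨j, k, hjk, m, rfl, hm⟩ := h
  let t := lastIdx n
  obtain ⟨l, hl1, hl2⟩ := exists_permOf_pair (a := t.castSucc) (b := t.succ)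
    Fin.castSucc_lt_succ.ne (Fin.castSucc_lt_succ_iff.2 hjk).ne
  have hV1 := cnt_act_reverse l T t.castSucc
  have hV0 := cnt_act_reverse l T t.succ
  rw [hl1] at hV1
  rw [hl2] at hV0
  rw [wt_eq, pairing_eq _ hjk, ← hV1, ← hV0] at hm
  have e1 := cnt_castSucc (act l.reverse T) t
  have e0 := cnt_succ (act l.reverse T) t
  rw [val_rev_lastIdx] at e1 e0
  -- The condition on `m` says that the new multiplicity lies between the two old ones. Hence it is
  -- attained on the string, and `toNat` does not truncate.
  obtain ⟨u, hu, hc⟩ := exists_str (j := 0) (w := (act l.reverse T).cword)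
    (a := ((act l.reverse T).cnt t.castSucc - m).toNat) (by omega)
  have hu' : Str t.rev (act l.reverse T).cword u := by
    rw [val_rev_lastIdx]
    exact hu
  obtain ⟨S, rfl⟩ := exists_of_str hu'
  have hcnt := cnt_of_str hu'
  have hadd := hu.count_add
  have e3 := cnt_castSucc S t
  rw [val_rev_lastIdx] at e3
  have hd : (act l.reverse T).cnt t.castSucc - S.cnt t.castSucc = pairing T.wt j k - m := by
    rw [wt_eq, pairing_eq _ hjk, ← hV1, ← hV0]
    omega
  refine ⟨act l S, ?_, ?_⟩
  · rw [wt_eq, cnt_act, hcnt, hd, posRoot_eq hjk, wt_eq, ← map_smul, ← map_sub]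
    refine congrArg wtOf ?_
    rw [sub_eq_add_neg (act l.reverse T).cnt, Pi.add_comp, Pi.neg_comp, Pi.smul_comp, root_comp,
      hl1, hl2, ← cnt_act, act_act_reverse, ← sub_eq_add_neg]
  · rw [orbit_act, ← orbit_act l.reverse T]
    exact Orbit.eqvGen_of_str (NeZero.one_le) hu

/-! ### The atomic decomposition -/

theorem isAtomicDecomposition_graphOneComponents :
    IsAtomicDecomposition lam (graphOneComponents lam) := by
  refine ⟨⟨?_, fun T => ?_⟩, ?_⟩
  · rintro ⟨c, hc⟩
    induction c using SimpleGraph.ConnectedComponent.ind with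
    | _ T =>
      have : T ∈ ((graphOne lam).connectedComponentMk T).supp := rfl
      simp only at hc
      rwa [hc] at this
  · refine ⟨_, ⟨⟨(graphOne lam).connectedComponentMk T, rfl⟩, rfl⟩, ?_⟩
    rintro _ ⟨⟨c, rfl⟩, hc⟩
    exact congrArg _ hc.symm
  · rintro _ ⟨c, rfl⟩
    induction c using SimpleGraph.ConnectedComponent.ind with
    | _ T =>
      have hmem : ∀ S : Crystal lam, S ∈ ((graphOne lam).connectedComponentMk T).supp ↔
          EqvGen Orbit.Down T.orbit S.orbit := fun S => by
        rw [SimpleGraph.ConnectedComponent.mem_supp_iff, SimpleGraph.ConnectedComponent.eq,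
          SimpleGraph.reachable_comm, reachable_iff]
      refine ⟨fun S hS S' hS' hw => ?_, ?_⟩
      · exact eq_of_wt_eq (((hmem S).1 hS).symm.trans _ _ _ ((hmem S').1 hS')) hw
      · obtain ⟨M, hM, hle⟩ := Orbit.exists_top T.orbit
        obtain ⟨S, rfl, -⟩ := (exists_lift_eqvGen hM).1 T rfl
        obtain ⟨D, hD, hDS⟩ := exists_isDominant S
        rw [← hDS] at hM hle
        refine ⟨D.wt, hD, Set.Subset.antisymm ?_ ?_⟩
        · rintro _ ⟨T', hT', rfl⟩
          obtain ⟨E, hE, hET, h1⟩ := exists_isDominant_le T'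
          obtain ⟨E', hE', hET', h2⟩ :=
            exists_bruhatLE_of_reflTransGen hD (hle _ ((hmem T').1 hT'))
          obtain rfl := eq_of_isDominant hE hE' (hET.trans hET'.symm)
          exact h1.trans h2
        · intro ν hν
          induction hν using ReflTransGen.head_induction_on with
          | refl => exact ⟨D, (hmem D).2 hM, rfl⟩
          | head h _ ih =>
            obtain ⟨T', hT', hw⟩ := ih
            simp only at hw
            rw [← hw] at h
            obtain ⟨S', hS', he⟩ := exists_of_bruhatStep h
            exact ⟨S', (hmem S').2 (((hmem T').1 hT').trans _ _ _ he), hS'⟩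

theorem graphOneComponents_eq_llAtoms : graphOneComponents lam = llAtoms lam := by
  have key : ∀ T : Crystal lam,
      ((graphOne lam).connectedComponentMk T).supp = {T' | LLEquiv lam T T'} := fun T => by
    ext S
    rw [SimpleGraph.ConnectedComponent.mem_supp_iff, SimpleGraph.ConnectedComponent.eq,
      SimpleGraph.reachable_comm, reachable_iff, Set.mem_ofPred_eq, llEquiv_iff]
  ext A
  constructor
  · rintro ⟨c, rfl⟩
    induction c using SimpleGraph.ConnectedComponent.ind with
    | _ T => exact ⟨T, key T⟩
  · rintro ⟨T, rfl⟩
    exact ⟨(graphOne lam).connectedComponentMk T, key T⟩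

end Components

end SLCrystal

theorem proposition1p9 (n : ℕ) [NeZero n] (lam : Fin n → ℕ) :
    SLCrystal.graphOneComponents lam = SLCrystal.llAtoms lam ∧
      SLCrystal.IsAtomicDecomposition lam (SLCrystal.graphOneComponents lam) :=
  ⟨SLCrystal.graphOneComponents_eq_llAtoms, SLCrystal.isAtomicDecomposition_graphOneComponents⟩
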